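/- Let $\mathbf K$ be $\mathbf R$ or $\mathbf C$, let $(Y,\mathcal B,\nu)$ be a $\sigma$-finite measure space, let $1<p<\infty$ and $1/p+1/q=1$, and let $L^p(Y)$ be the space of $\mathbf K$-valued $L^p$ functions on $Y$. Equip $\mathbf R\times Y$ with the product of Lebesgue measure and $\nu$. The length of a map $f$ from $[a,b]$ into a normed space is $\sup\sum_{j=1}^n\|f(t_j)-f(t_{j-1})\|$ over all partitions $a=t_0<\dots<t_n=b$; a path of finite length need not be continuous. Differentiability of a map into a normed space always refers to norm limits of difference quotients. 1. Let $f:\mathbf R\to L^p(Y)$ be Lipschitz. There is a function $G:\mathbf R\times Y\to\mathbf K$ with $G\in L^p([a,b]\times Y)$ for all real $a,b$, such that $$f(t)-f(r)=\int_r^t G(x,\cdot)\,dx\qquad(r<t),$$ where the right side is the Bochner integral of the integrable $L^p(Y)$-valued function $x\mapsto G(x,\cdot)$ on $[r,t]$. Moreover $f$ is differentiable at almost every $x\in\mathbf R$, with derivative $f'(x)=G(x,\cdot)$. If in addition $f$ has compact support, then $G\in L^p(\mathbf R\times Y)$, and for every $\Phi\in L^q(\mathbf R\times Y)$, $$\lim_{h\to0}\int_{\mathbf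 R}\Big(\int_Y\frac{f(x+h)(y)-f(x)(y)}{h}\,\Phi(x,y)\,d\nu(y)\Big)dx=\int_{\mathbf R\times Y}G\,\Phi\,dx\,d\nu.$$ 2. If $a<b$ and $f:[a,b]\to L^p(Y)$ has finite length, then $f$ is differentiable at almost every point of $(a,b)$. 3. If $f:\mathbf R\to L^p(Y)$ is continuous with compact support, then $$\Lambda(\Phi)=\int_{\mathbf R}\Big(\int_Y f(x)(y)\,\Phi(x,y)\,d\nu(y)\Big)dx$$ is a well-defined bounded linear functional on $L^q(\mathbf R\times Y)$: the inner integrand is integrable for almost every $x$, the inner integral is an integrable function of $x$, and $\|\Lambda\|\le\big(\int_{\mathbf R}\|f(x)\|_{L^p(Y)}^p\,dx\big)^{1/p}$. 4. Let $1\le s\le\infty$, let $\ell^s$ be the space of $s$-summable (bounded, if $s=\infty$) $\mathbf K$-valued sequences, and let $f=(f_j)_j:\mathbf R\to\ell^s$ be Lipschitz with constant $k$. Then for almost every $x$ all the $f_j$ are differentiable at $x$; at every $x$ where all the $f_j$ are differentiable, $(f_j'(x))_j\in\ell^s$ with norm at most $k$; and for each $j$ and $r<t$, $f_j'$ is integrable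 on $[r,t]$ and $f_j(t)-f_j(r)=\int_r^t f_j'(x)\,dx$. If $s<\infty$, then $f$ is differentiable almost everywhere as a map into $\ell^s$, with derivative $(f_j'(x))_j$. 5. Let $H$ be any real or complex Hilbert space, not necessarily separable. Every Lipschitz map $\mathbf R\to H$ is differentiable almost everywhere, and if $a<b$, every path $f:[a,b]\to H$ of finite length is differentiable at almost every point of $(a,b)$. -/

import Mathlib

open MeasureTheory Filter Topology
open scoped ENNReal NNReal

/-- The section `G(x, ·)` of a function `G` on `ℝ × Y`, as an element of `L^p(Y)`. It is set to `0`
at those `x` for which `G(x, ·)` is not in `L^p`; when `G` is in `L^p((a, b) × Y)` with `p < ∞`,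
Fubini's theorem says that these `x` form a null subset of `(a, b)`. -/
noncomputable def sectionLp {𝕜 Y : Type*} [RCLike 𝕜] [MeasurableSpace Y] (p : ℝ≥0∞)
    (ν : Measure Y) (G : ℝ × Y → 𝕜) (x : ℝ) : Lp 𝕜 p ν :=
  open scoped Classical in
  if h : MemLp (fun y => G (x, y)) p ν then h.toLp (fun y => G (x, y)) else 0

/-- The iterated integral `∫_ℝ (∫_Y f(x)(y) Φ(x, y) dν(y)) dx`, for `f : ℝ → L^p(Y)`. -/
noncomputable def pairingIntegral {𝕜 Y : Type*} [RCLike 𝕜] [MeasurableSpace Y] {p : ℝ≥0∞}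
    {ν : Measure Y} (f : ℝ → Lp 𝕜 p ν) (Φ : ℝ × Y → 𝕜) : 𝕜 :=
  ∫ x : ℝ, ∫ y : Y, f x y * Φ (x, y) ∂ν

/-! ### Extension of Lipschitz curves; reduction from finite length to Lipschitz -/

section LipschitzCurves

variable {E : Type*} [NormedAddCommGroup E] [NormedSpace ℝ E]

/-! For a Lipschitz curve, the slopes over dyadic intervals form a bounded vector-valued martingale.
Suppose `Ψ` is uniformly convex on balls. By Jensen, the integrals of `Ψ` along the martingale
increase and are bounded, hence converge. Jensen applied to the midpoint of two slopes then makes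
the integrated convexity gap small, so the martingale is Cauchy in L¹
(`UniformlyConvexOnBalls.dyadicSlope_cauchy`). Its limit is a density of the curve, and Lebesgue
differentiation gives the derivative almost everywhere.

A suitable `Ψ` is the `p`-th power of the norm: in a Hilbert space with `p = 2` by the parallelogram
law, in `L^p` by integrating the scalar inequality (`HasPowerModulus.lp`).

A curve of finite length is a Lipschitz curve composed with a monotone expanding change of
parameter, which is differentiable almost everywhere and pulls null sets back to null sets.

The function `G` is a jointly measurable representative of `deriv f`. By Tonelli its `L^p` norm is
that of the vector-valued map, so the statements on functionals follow from Hölder and dominated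
convergence. For `ℓ^s`, which may lack uniform convexity, the coordinates are differentiated
separately; if `s < ∞`, the vector of derivatives is strongly measurable and serves as the density.
-/

theorem LipschitzOnWith.exists_extend_closure {X F : Type*} [PseudoMetricSpace X] [MetricSpace F]
    [CompleteSpace F] {S : Set X} {K : ℝ≥0} {f : X → F} (hf : LipschitzOnWith K f S) :
    ∃ g : X → F, LipschitzOnWith K g (closure S) ∧ Set.EqOn g f S := by
  have hlim : ∀ x ∈ closure S, ∃ y, Tendsto f (𝓝[S] x) (𝓝 y) := by
    intro x hx
    have : (𝓝[S] x).NeBot := mem_closure_iff_nhdsWithin_neBot.1 hx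
    have hc : Cauchy (𝓝[S] x) := cauchy_nhds.mono inf_le_left
    exact CompleteSpace.complete (hc.map_of_le hf.uniformContinuousOn inf_le_right)
  have heq : Set.EqOn (extendFrom S f) f S := fun x hx =>
    extendFrom_eq (subset_closure hx) (hf.continuousOn x hx)
  refine ⟨extendFrom S f, LipschitzOnWith.closure (continuousOn_extendFrom subset_rfl hlim) ?_, heq⟩
  intro x hx y hy
  rw [heq hx, heq hy]
  exact hf hx hy

/-- Linear interpolation across the gaps of `S` keeps the constant in any normed space, since every
chord has slope at most `K`. As `S` is unbounded on both sides, each gap has two endpoints. -/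
theorem LipschitzOnWith.exists_extend_real_of_isClosed {S : Set ℝ} {K : ℝ≥0} {f : ℝ → E}
    (hf : LipschitzOnWith K f S) (hS : IsClosed S) (hb : ∀ x, ∃ y ∈ S, y ≤ x)
    (ha : ∀ x, ∃ y ∈ S, x ≤ y) : ∃ g : ℝ → E, LipschitzWith K g ∧ Set.EqOn g f S := by
  have hα : ∀ x, ∃ u ∈ S, u ≤ x ∧ ∀ s ∈ S, s ≤ x → s ≤ u := fun x => by
    obtain ⟨y, hy, hyx⟩ := hb x
    have hB : BddAbove (S ∩ Set.Iic x) := ⟨x, fun s hs => hs.2⟩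
    have := (hS.inter isClosed_Iic).csSup_mem ⟨y, hy, hyx⟩ hB
    exact ⟨_, this.1, this.2, fun s hs hsx => le_csSup hB ⟨hs, hsx⟩⟩
  have hβ : ∀ x, ∃ u ∈ S, x ≤ u ∧ ∀ s ∈ S, x ≤ s → u ≤ s := fun x => by
    obtain ⟨y, hy, hyx⟩ := ha x
    have hB : BddBelow (S ∩ Set.Ici x) := ⟨x, fun s hs => hs.2⟩
    have := (hS.inter isClosed_Ici).csInf_mem ⟨y, hy, hyx⟩ hB
    exact ⟨_, this.1, this.2, fun s hs hsx => csInf_le hB ⟨hs, hsx⟩⟩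
  choose α hαS hαle hαmax using hα
  choose β hβS hβle hβmin using hβ
  have hfd : ∀ x ∈ S, ∀ y ∈ S, ‖f x - f y‖ ≤ K * |x - y| := fun x hx y hy => by
    simpa [dist_eq_norm] using hf.dist_le_mul x hx y hy
  -- `α x` and `β x` are the nearest points of `S` on the left and on the right of `x`.
  set g : ℝ → E := fun x => f (α x) + ((x - α x) / (β x - α x)) • (f (β x) - f (α x)) with hg
  have heq : Set.EqOn g f S := fun x hx => by
    have h1 : α x = x := le_antisymm (hαle x) (hαmax x x hx le_rfl)
    simp [hg, h1]
  have hsame : ∀ x y, x ≤ y → α x = α y → β x = β y → ‖g y - g x‖ ≤ K * (y - x) := by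
    intro x y hxy h1 h2
    have h3 : g y - g x = ((y - x) / (β x - α x)) • (f (β x) - f (α x)) := by
      simp only [hg, ← h1, ← h2]
      rw [add_sub_add_left_eq_sub, ← sub_smul]
      congr 1
      ring
    rcases (hαle x).trans (hβle x) |>.eq_or_lt with h | h
    · rw [h3, h]
      simpa using mul_nonneg K.2 (sub_nonneg.2 hxy)
    · have h4 := hfd _ (hβS x) _ (hαS x)
      rw [h3, norm_smul, Real.norm_of_nonneg (div_nonneg (sub_nonneg.2 hxy) (sub_pos.2 h).le),
        div_mul_eq_mul_div, div_le_iff₀ (sub_pos.2 h)]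
      rw [abs_of_pos (sub_pos.2 h)] at h4
      nlinarith [mul_le_mul_of_nonneg_left h4 (sub_nonneg.2 hxy)]
  have hmono : ∀ x y, x ≤ y → ‖g y - g x‖ ≤ K * (y - x) := by
    intro x y hxy
    -- If `S` meets `[x, y]`, split at `β x ≤ α y`; otherwise both points lie in one gap, where `g`
    -- is affine.
    by_cases hs : ∃ s ∈ S, x ≤ s ∧ s ≤ y
    · obtain ⟨s, hsS, hxs, hsy⟩ := hs
      have hβx := hβmin x s hsS hxs
      have hαy := hαmax y s hsS hsy
      have idα : ∀ z ∈ S, α z = z := fun z hz => le_antisymm (hαle z) (hαmax z z hz le_rfl)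
      have idβ : ∀ z ∈ S, β z = z := fun z hz => le_antisymm (hβmin z z hz le_rfl) (hβle z)
      have e1 : ‖g (β x) - g x‖ ≤ K * (β x - x) := by
        by_cases hx : x ∈ S
        · rw [idβ x hx]; simp
        · have hlt : x < β x := lt_of_le_of_ne (hβle x) fun h => hx (h ▸ hβS x)
          have hlt' : α x < x := lt_of_le_of_ne (hαle x) fun h => hx (h ▸ hαS x)
          have h5 : g (β x) - g x
              = ((β x - x) / (β x - α x)) • (f (β x) - f (α x)) := by
            rw [heq (hβS x)]
            have h0 : β x - α x ≠ 0 := by linarith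
            have : (β x - x) / (β x - α x) = 1 - (x - α x) / (β x - α x) := by
              field_simp; ring
            rw [this, sub_smul, one_smul]
            simp only [hg]
            abel
          have h4 := hfd _ (hβS x) _ (hαS x)
          have hpos : 0 < β x - α x := by linarith
          rw [h5, norm_smul, Real.norm_of_nonneg (div_nonneg (by linarith) hpos.le),
            div_mul_eq_mul_div, div_le_iff₀ hpos]
          rw [abs_of_pos hpos] at h4
          nlinarith [mul_le_mul_of_nonneg_left h4 (sub_nonneg.2 hlt.le)]
      have e2 : ‖g y - g (α y)‖ ≤ K * (y - α y) := by
        by_cases hy : y ∈ S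
        · rw [idα y hy]; simp
        · have hlt : y < β y := lt_of_le_of_ne (hβle y) fun h => hy (h ▸ hβS y)
          have h5 : g y - g (α y) = ((y - α y) / (β y - α y)) • (f (β y) - f (α y)) := by
            rw [heq (hαS y)]
            simp only [hg]
            abel
          have h4 := hfd _ (hβS y) _ (hαS y)
          have hpos : 0 < β y - α y := by linarith [hαle y]
          rw [h5, norm_smul, Real.norm_of_nonneg (div_nonneg (by linarith [hαle y]) hpos.le),
            div_mul_eq_mul_div, div_le_iff₀ hpos]
          rw [abs_of_pos hpos] at h4
          nlinarith [mul_le_mul_of_nonneg_left h4 (sub_nonneg.2 (hαle y))]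
      have e3 : ‖g (α y) - g (β x)‖ ≤ K * (α y - β x) := by
        rw [heq (hαS y), heq (hβS x)]
        refine (hfd _ (hαS y) _ (hβS x)).trans_eq ?_
        rw [abs_of_nonneg (by linarith)]
      calc ‖g y - g x‖ = ‖(g y - g (α y)) + (g (α y) - g (β x)) + (g (β x) - g x)‖ := by
            congr 1; abel
        _ ≤ ‖g y - g (α y)‖ + ‖g (α y) - g (β x)‖ + ‖g (β x) - g x‖ := norm_add₃_le
        _ ≤ K * (y - x) := by linarith
    · push Not at hs
      refine hsame x y hxy ?_ ?_
      · refine le_antisymm (hαmax y _ (hαS x) ((hαle x).trans hxy)) (hαmax x _ (hαS y) ?_)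
        by_contra! h
        exact (hs _ (hαS y) h.le).not_ge (hαle y)
      · refine le_antisymm (hβmin x _ (hβS y) (hxy.trans (hβle y))) (hβmin y _ (hβS x) ?_)
        exact (hs _ (hβS x) (hβle x)).le
  refine ⟨g, LipschitzWith.of_dist_le_mul fun x y => ?_, heq⟩
  rw [dist_eq_norm, Real.dist_eq]
  rcases le_total x y with h | h
  · rw [norm_sub_rev, abs_sub_comm, abs_of_nonneg (sub_nonneg.2 h)]
    exact hmono x y h
  · rw [abs_of_nonneg (sub_nonneg.2 h)]
    exact hmono y x h

variable [CompleteSpace E]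

theorem LipschitzWith.intervalIntegrable_deriv {K : ℝ≥0} {f : ℝ → E} (hf : LipschitzWith K f)
    (r t : ℝ) : IntervalIntegrable (deriv f) volume r t := by
  refine (intervalIntegrable_const (c := (K : ℝ))).mono_fun'
    (stronglyMeasurable_deriv f).aestronglyMeasurable (Eventually.of_forall fun x => ?_)
  exact norm_deriv_le_of_lipschitz hf

/-- The difference of `f` and the integral of its derivative is Lipschitz, hence absolutely
continuous, and has derivative zero almost everywhere, so it is constant. -/
theorem LipschitzWith.integral_deriv_eq_sub_of_ae {K : ℝ≥0} {f : ℝ → E} (hf : LipschitzWith K f)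
    (hd : ∀ᵐ x : ℝ, DifferentiableAt ℝ f x) (r t : ℝ) :
    ∫ x in r..t, deriv f x = f t - f r := by
  have hi := hf.intervalIntegrable_deriv r t
  have hgL : LipschitzOnWith (K + K) (fun x => f x - ∫ s in r..x, deriv f s) (Set.uIcc r t) := by
    refine LipschitzOnWith.of_dist_le_mul fun x _ y _ => ?_
    have h1 : (∫ s in r..x, deriv f s) - ∫ s in r..y, deriv f s = ∫ s in y..x, deriv f s :=
      intervalIntegral.integral_interval_sub_left (hf.intervalIntegrable_deriv _ _)
        (hf.intervalIntegrable_deriv _ _)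
    have h2 : ‖∫ s in y..x, deriv f s‖ ≤ K * |x - y| :=
      intervalIntegral.norm_integral_le_of_norm_le_const fun s _ => norm_deriv_le_of_lipschitz hf
    have h3 : ‖f x - f y‖ ≤ K * |x - y| := by
      simpa [dist_eq_norm] using hf.dist_le_mul x y
    have h4 : (f x - ∫ s in r..x, deriv f s) - (f y - ∫ s in r..y, deriv f s)
        = (f x - f y) - ∫ s in y..x, deriv f s := by rw [← h1]; abel
    rw [dist_eq_norm, h4, Real.dist_eq]
    refine (_root_.norm_sub_le _ _).trans ?_
    push_cast
    linarith
  have hg0 : ∀ᵐ x, x ∈ Set.uIcc r t →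
      HasDerivAt (fun x => f x - ∫ s in r..x, deriv f s) 0 x := by
    filter_upwards [hd, hi.ae_hasDerivAt_integral] with x hx1 hx2 hx3
    have h := hx1.hasDerivAt.sub (hx2 hx3 r (by simp))
    rwa [sub_self] at h
  obtain ⟨C, hC⟩ := hgL.absolutelyContinuousOnInterval.const_of_ae_hasDerivAt_zero hg0
  have h1 := hC r (by simp)
  have h2 := hC t (by simp)
  simp only [intervalIntegral.integral_same, sub_zero] at h1
  rw [h1, ← h2]
  abel

theorem LipschitzOnWith.exists_extend_real {S : Set ℝ} {K : ℝ≥0} {f : ℝ → E}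
    (hf : LipschitzOnWith K f S) (hb : ∀ x, ∃ y ∈ S, y ≤ x)
    (ha : ∀ x, ∃ y ∈ S, x ≤ y) : ∃ g : ℝ → E, LipschitzWith K g ∧ Set.EqOn g f S := by
  obtain ⟨g, hg, hgf⟩ := hf.exists_extend_closure
  obtain ⟨k, hk, hkg⟩ := hg.exists_extend_real_of_isClosed isClosed_closure
    (fun x => (hb x).imp fun y hy => ⟨subset_closure hy.1, hy.2⟩)
    (fun x => (ha x).imp fun y hy => ⟨subset_closure hy.1, hy.2⟩)
  exact ⟨k, hk, fun x hx => (hkg (subset_closure hx)).trans (hgf hx)⟩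

/-- If Lipschitz curves in `E` are almost everywhere differentiable, so are curves of bounded
variation. -/
theorem BoundedVariationOn.ae_differentiableAt_of_forall_lipschitz
    (hE : ∀ (K : ℝ≥0) (f : ℝ → E), LipschitzWith K f → ∀ᵐ x : ℝ, DifferentiableAt ℝ f x)
    {f : ℝ → E} (hf : BoundedVariationOn f Set.univ) : ∀ᵐ x : ℝ, DifferentiableAt ℝ f x := by
  have hloc := hf.locallyBoundedVariationOn
  set v := variationOnFromTo f Set.univ 0 with hv
  -- Adding `x` to the variation makes the parameter expanding, hence injective even where `f` is
  -- constant; `f` is still 1-Lipschitz as a function of `w`.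
  set w : ℝ → ℝ := fun x => x + v x with hw
  have hvm : Monotone v := monotoneOn_univ.1 (variationOnFromTo.monotoneOn hloc (Set.mem_univ 0))
  have hfv : ∀ x y, x ≤ y → ‖f y - f x‖ ≤ v y - v x := by
    intro x y hxy
    have h1 : v y - v x = variationOnFromTo f Set.univ x y :=
      variationOnFromTo.sub_right hloc trivial trivial trivial
    rw [h1, variationOnFromTo.eq_of_le _ _ hxy, ← dist_eq_norm, dist_edist]
    refine ENNReal.toReal_mono (hloc x y trivial trivial) ?_
    exact eVariationOn.edist_le _ ⟨trivial, hxy, le_rfl⟩ ⟨trivial, le_rfl, hxy⟩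
  have hwx : ∀ x y, x ≤ y → y - x ≤ w y - w x := fun x y h => by
    have := hvm h
    simp only [hw]; linarith
  have hwf : ∀ x y, ‖f x - f y‖ ≤ |w x - w y| := by
    intro x y
    rcases le_total x y with h | h
    · rw [norm_sub_rev, abs_sub_comm]
      refine (hfv x y h).trans (le_trans ?_ (le_abs_self _))
      simp only [hw]; linarith
    · refine (hfv y x h).trans (le_trans ?_ (le_abs_self _))
      simp only [hw]; linarith
  have hanti : AntilipschitzWith 1 w := by
    refine AntilipschitzWith.of_le_mul_dist fun x y => ?_
    rw [NNReal.coe_one, one_mul, Real.dist_eq, Real.dist_eq]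
    rcases le_total x y with h | h
    · rw [abs_sub_comm, abs_sub_comm (w x), abs_of_nonneg (sub_nonneg.2 h)]
      exact (hwx x y h).trans (le_abs_self _)
    · rw [abs_of_nonneg (sub_nonneg.2 h)]
      exact (hwx y x h).trans (le_abs_self _)
  have hinj := hanti.injective
  have hL : LipschitzOnWith 1 (f ∘ Function.invFun w) (Set.range w) := by
    refine LipschitzOnWith.of_dist_le_mul ?_
    rintro _ ⟨x, rfl⟩ _ ⟨y, rfl⟩
    simp only [Function.comp, Function.leftInverse_invFun hinj _, dist_eq_norm, NNReal.coe_one,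
      one_mul]
    exact hwf x y
  obtain ⟨F, hF, hFf⟩ := hL.exists_extend_real
    (fun x => by
      refine ⟨_, ⟨min 0 (x - v 0), rfl⟩, ?_⟩
      have := hvm (min_le_left 0 (x - v 0))
      have := min_le_right 0 (x - v 0)
      simp only [hw]; linarith)
    (fun x => by
      refine ⟨_, ⟨max 0 (x - v 0), rfl⟩, ?_⟩
      have := hvm (le_max_left 0 (x - v 0))
      have := le_max_right 0 (x - v 0)
      simp only [hw]; linarith)
  have hcomp : f = F ∘ w := funext fun x => by
    simp [hFf ⟨x, rfl⟩, Function.leftInverse_invFun hinj _]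
  -- Preimages under the expanding map `w` do not increase one-dimensional Hausdorff measure, which
  -- is Lebesgue measure.
  have hnull : ∀ᵐ x : ℝ, DifferentiableAt ℝ F (w x) := by
    have h1 := hE 1 F hF
    rw [ae_iff] at h1 ⊢
    have h2 := hanti.hausdorffMeasure_preimage_le zero_le_one {a | ¬DifferentiableAt ℝ F a}
    rw [hausdorffMeasure_real, h1, mul_zero] at h2
    exact le_antisymm h2 bot_le
  have hwd : ∀ᵐ x : ℝ, DifferentiableAt ℝ w x :=
    (monotone_id.add hvm).ae_differentiableAt
  filter_upwards [hnull, hwd] with x h1 h2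
  rw [hcomp]
  exact h1.comp x h2

theorem BoundedVariationOn.ae_differentiableAt_Ioo_of_forall_lipschitz
    (hE : ∀ (K : ℝ≥0) (f : ℝ → E), LipschitzWith K f → ∀ᵐ x : ℝ, DifferentiableAt ℝ f x)
    {a b : ℝ} (hab : a < b) {f : ℝ → E} (hf : BoundedVariationOn f (Set.Icc a b)) :
    ∀ᵐ x : ℝ, x ∈ Set.Ioo a b → DifferentiableAt ℝ f x := by
  -- Clamping to `[a, b]` keeps the variation finite and changes nothing near a point of the open
  -- interval.
  set c : ℝ → ℝ := fun x => max a (min b x) with hc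
  have hcm : Monotone c := monotone_const.max (monotone_const.min monotone_id)
  have hbv : BoundedVariationOn (f ∘ c) Set.univ := ne_top_of_le_ne_top hf
    (eVariationOn.comp_le_of_monotoneOn f c (hcm.monotoneOn _) fun x _ =>
      ⟨le_max_left _ _, max_le hab.le (min_le_left _ _)⟩)
  filter_upwards [hbv.ae_differentiableAt_of_forall_lipschitz hE] with x hx hxab
  refine hx.congr_of_eventuallyEq ?_
  filter_upwards [isOpen_Ioo.mem_nhds hxab] with y hy
  simp [hc, min_eq_right hy.2.le, max_eq_right hy.1.le]

end LipschitzCurves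

/-! ### Convergence of the martingale of dyadic slopes -/

section DyadicMartingale

variable {E : Type*} [NormedAddCommGroup E]

theorem MeasureTheory.StronglyMeasurable.intervalIntegrable_of_norm_le {g : ℝ → E} {C : ℝ}
    (hg : StronglyMeasurable g) (hC : ∀ x, ‖g x‖ ≤ C) (a b : ℝ) :
    IntervalIntegrable g volume a b :=
  (intervalIntegrable_const (c := C)).mono_fun' hg.aestronglyMeasurable (Eventually.of_forall hC)

variable [NormedSpace ℝ E]

/-- A convex function on `E` that controls the distance of two points of a ball by the gap in the
midpoint convexity inequality. -/
structure UniformlyConvexOnBalls (Ψ : E → ℝ) : Prop where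
  continuous : Continuous Ψ
  convexOn : ConvexOn ℝ Set.univ Ψ
  bounded : ∀ R : ℝ, ∃ B : ℝ, ∀ u, ‖u‖ ≤ R → |Ψ u| ≤ B
  modulus : ∀ R ε : ℝ, 0 < ε → ∃ C : ℝ, ∀ u v, ‖u‖ ≤ R → ‖v‖ ≤ R →
    ‖u - v‖ ≤ ε + C * ((Ψ u + Ψ v) / 2 - Ψ ((1 / 2 : ℝ) • (u + v)))

/-- The slope of `f` on the dyadic interval `[k / 2 ^ n, (k + 1) / 2 ^ n)` that contains `x`. -/
noncomputable def dyadicSlope (f : ℝ → E) (n : ℕ) (x : ℝ) : E :=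
  (2 : ℝ) ^ n • (f ((⌊(2 : ℝ) ^ n * x⌋ + 1) / 2 ^ n) - f (⌊(2 : ℝ) ^ n * x⌋ / 2 ^ n))

theorem stronglyMeasurable_dyadicSlope (f : ℝ → E) (n : ℕ) :
    StronglyMeasurable (dyadicSlope f n) := by
  have h : StronglyMeasurable (fun k : ℤ =>
      (2 : ℝ) ^ n • (f (((k : ℝ) + 1) / 2 ^ n) - f ((k : ℝ) / 2 ^ n))) :=
    StronglyMeasurable.of_discrete
  exact h.comp_measurable (Int.measurable_floor.comp (measurable_const_mul _))

theorem norm_dyadicSlope_le {K : ℝ≥0} {f : ℝ → E} (hf : LipschitzWith K f) (n : ℕ) (x : ℝ) :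
    ‖dyadicSlope f n x‖ ≤ K := by
  have h2 : (0 : ℝ) < 2 ^ n := by positivity
  have h := hf.dist_le_mul ((⌊(2 : ℝ) ^ n * x⌋ + 1) / 2 ^ n) (⌊(2 : ℝ) ^ n * x⌋ / 2 ^ n)
  rw [dist_eq_norm, Real.dist_eq, ← sub_div, add_sub_cancel_left, abs_of_pos (by positivity)] at h
  rw [dyadicSlope, norm_smul, Real.norm_of_nonneg h2.le]
  calc (2 : ℝ) ^ n * _ ≤ 2 ^ n * (K * (1 / 2 ^ n)) := mul_le_mul_of_nonneg_left h h2.le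
    _ = K := by field_simp

theorem dyadicSlope_of_mem_Ico (f : ℝ → E) {n k : ℕ} {x : ℝ}
    (hx : x ∈ Set.Ico ((k : ℝ) / 2 ^ n) ((k + 1) / 2 ^ n)) :
    dyadicSlope f n x = (2 : ℝ) ^ n • (f ((k + 1) / 2 ^ n) - f (k / 2 ^ n)) := by
  have h2 : (0 : ℝ) < 2 ^ n := by positivity
  have : ⌊(2 : ℝ) ^ n * x⌋ = (k : ℤ) := by
    rw [Int.floor_eq_iff]
    have h3 := hx.1
    have h4 := hx.2
    rw [div_le_iff₀ h2] at h3
    rw [lt_div_iff₀ h2] at h4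
    push_cast
    constructor <;> linarith
  rw [dyadicSlope, this]
  push_cast
  rfl

/-- Interval integrals live on `Ioc`, the slope is constant on `Ico`; only an endpoint is lost. -/
theorem ae_dyadicSlope_eq (f : ℝ → E) (n k : ℕ) :
    ∀ᵐ x : ℝ, x ∈ Set.Ioc ((k : ℝ) / 2 ^ n) ((k + 1) / 2 ^ n) →
      dyadicSlope f n x = (2 : ℝ) ^ n • (f ((k + 1) / 2 ^ n) - f (k / 2 ^ n)) := by
  have h : ∀ᵐ x : ℝ, x ≠ ((k : ℝ) + 1) / 2 ^ n := by simp [ae_iff, measure_singleton]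
  filter_upwards [h] with x hx hxI
  exact dyadicSlope_of_mem_Ico f ⟨hxI.1.le, lt_of_le_of_ne hxI.2 hx⟩

theorem dyadic_le (n k : ℕ) : (k : ℝ) / 2 ^ n ≤ (k + 1) / 2 ^ n := by
  gcongr
  linarith

theorem integral_comp_dyadicSlope {F : Type*} [NormedAddCommGroup F] [NormedSpace ℝ F]
    [CompleteSpace F] (f : ℝ → E) (Ψ : E → F) (n k : ℕ) :
    ∫ x in ((k : ℝ) / 2 ^ n)..((k + 1) / 2 ^ n), Ψ (dyadicSlope f n x)
      = (1 / 2 ^ n : ℝ) • Ψ ((2 : ℝ) ^ n • (f ((k + 1) / 2 ^ n) - f (k / 2 ^ n))) := by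
  have h : ∫ x in ((k : ℝ) / 2 ^ n)..((k + 1) / 2 ^ n), Ψ (dyadicSlope f n x)
      = ∫ x in ((k : ℝ) / 2 ^ n)..((k + 1) / 2 ^ n),
        Ψ ((2 : ℝ) ^ n • (f ((k + 1) / 2 ^ n) - f (k / 2 ^ n))) := by
    refine intervalIntegral.integral_congr_ae ?_
    rw [Set.uIoc_of_le (dyadic_le n k)]
    filter_upwards [ae_dyadicSlope_eq f n k] with x hx hxI
    rw [hx hxI]
  rw [h, intervalIntegral.integral_const]
  congr 1
  ring

theorem UniformlyConvexOnBalls.intervalIntegrable_comp {Ψ : E → ℝ} (hΨ : UniformlyConvexOnBalls Ψ)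
    {h : ℝ → E} {C : ℝ} (hm : StronglyMeasurable h) (hC : ∀ x, ‖h x‖ ≤ C) (a b : ℝ) :
    IntervalIntegrable (fun x => Ψ (h x)) volume a b := by
  obtain ⟨B, hB⟩ := hΨ.bounded C
  exact (hΨ.continuous.comp_stronglyMeasurable hm).intervalIntegrable_of_norm_le
    (fun x => hB _ (hC x)) a b

variable [CompleteSpace E]

theorem integral_dyadicSlope_step (f : ℝ → E) (n k : ℕ) :
    ∫ x in ((k : ℝ) / 2 ^ n)..((k + 1) / 2 ^ n), dyadicSlope f n x
      = f ((k + 1) / 2 ^ n) - f (k / 2 ^ n) := by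
  have h := integral_comp_dyadicSlope f (fun u => u) n k
  rw [h, smul_smul, one_div, inv_mul_cancel₀ (by positivity), one_smul]

theorem integral_dyadicSlope {K : ℝ≥0} {f : ℝ → E} (hf : LipschitzWith K f) (n : ℕ) {i j : ℕ}
    (hij : i ≤ j) :
    ∫ x in ((i : ℝ) / 2 ^ n)..((j : ℝ) / 2 ^ n), dyadicSlope f n x
      = f (j / 2 ^ n) - f (i / 2 ^ n) := by
  have h := intervalIntegral.sum_integral_adjacent_intervals_Ico (μ := volume)
    (f := dyadicSlope f n) (a := fun k : ℕ => (k : ℝ) / 2 ^ n) hij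
    (fun k _ => (stronglyMeasurable_dyadicSlope f n).intervalIntegrable_of_norm_le
      (norm_dyadicSlope_le hf n) _ _)
  rw [← h]
  push_cast
  rw [Finset.sum_congr rfl fun k _ => integral_dyadicSlope_step f n k]
  have h2 := Finset.sum_Ico_sub (fun k : ℕ => f ((k : ℝ) / 2 ^ n)) hij
  push_cast at h2
  exact h2

/-- This is the martingale property: averaging a finer slope over a coarser dyadic interval gives
back the coarser slope. -/
theorem integral_dyadicSlope_of_le {K : ℝ≥0} {f : ℝ → E} (hf : LipschitzWith K f) {n m : ℕ}
    (hnm : n ≤ m) (k : ℕ) :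
    ∫ x in ((k : ℝ) / 2 ^ n)..((k + 1) / 2 ^ n), dyadicSlope f m x
      = f ((k + 1) / 2 ^ n) - f (k / 2 ^ n) := by
  obtain ⟨d, rfl⟩ := Nat.exists_eq_add_of_le hnm
  have e : ∀ c : ℝ, c / 2 ^ n = (c * 2 ^ d) / 2 ^ (n + d) := fun c => by
    rw [pow_add]; field_simp
  have h := integral_dyadicSlope hf (n + d) (i := k * 2 ^ d) (j := (k + 1) * 2 ^ d)
    (Nat.mul_le_mul_right _ (Nat.le_succ k))
  push_cast at h
  rwa [← e, ← e] at h

theorem ConvexOn.map_intervalAverage_le {Ψ : E → ℝ} (hΨ : ConvexOn ℝ Set.univ Ψ)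
    (hc : Continuous Ψ) {a b : ℝ} (hab : a < b) {h : ℝ → E}
    (hi : IntervalIntegrable h volume a b) (hi' : IntervalIntegrable (Ψ ∘ h) volume a b) :
    (b - a) * Ψ ((b - a)⁻¹ • ∫ x in a..b, h x) ≤ ∫ x in a..b, Ψ (h x) := by
  have hv : volume.real (Set.Ioc a b) = b - a := by
    rw [Real.volume_real_Ioc_of_le hab.le]
  have h1 := hΨ.map_set_average_le (μ := volume) (t := Set.Ioc a b) hc.continuousOn isClosed_univ
    (by simp [hab]) (by simp) (Eventually.of_forall fun x => trivial)
    ((intervalIntegrable_iff_integrableOn_Ioc_of_le hab.le).1 hi)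
    ((intervalIntegrable_iff_integrableOn_Ioc_of_le hab.le).1 hi')
  rw [setAverage_eq, setAverage_eq, hv, ← intervalIntegral.integral_of_le hab.le,
    ← intervalIntegral.integral_of_le hab.le, smul_eq_mul, ← div_eq_inv_mul,
    le_div_iff₀ (sub_pos.2 hab), mul_comm] at h1
  exact h1

/-- The hypothesis `hh` says that the level-`n` slope is the conditional expectation of `h` on
dyadic intervals, so Jensen applies on each of them. It is used for `h` a finer slope and for `h` a
midpoint of two slopes. -/
theorem UniformlyConvexOnBalls.integral_dyadicSlope_le {Ψ : E → ℝ}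
    (hΨ : UniformlyConvexOnBalls Ψ) {K : ℝ≥0} {f : ℝ → E} (hf : LipschitzWith K f) (n : ℕ)
    {h : ℝ → E} {C : ℝ} (hm : StronglyMeasurable h) (hC : ∀ x, ‖h x‖ ≤ C)
    (hh : ∀ k : ℕ, ∫ x in ((k : ℝ) / 2 ^ n)..((k + 1) / 2 ^ n), h x
      = f ((k + 1) / 2 ^ n) - f (k / 2 ^ n)) :
    ∫ x in (0 : ℝ)..1, Ψ (dyadicSlope f n x) ≤ ∫ x in (0 : ℝ)..1, Ψ (h x) := by
  have hsum : ∀ φ : ℝ → ℝ, (∀ a b, IntervalIntegrable φ volume a b) →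
      ∑ k ∈ Finset.range (2 ^ n), ∫ x in ((k : ℝ) / 2 ^ n)..((k + 1) / 2 ^ n), φ x
        = ∫ x in (0 : ℝ)..1, φ x := by
    intro φ hφ
    have := intervalIntegral.sum_integral_adjacent_intervals (μ := volume)
      (f := φ) (a := fun k : ℕ => (k : ℝ) / 2 ^ n) (n := 2 ^ n) (fun k _ => hφ _ _)
    push_cast at this
    rwa [zero_div, div_self (by positivity)] at this
  rw [← hsum _ (hΨ.intervalIntegrable_comp (stronglyMeasurable_dyadicSlope f n)
    (norm_dyadicSlope_le hf n)), ← hsum _ (hΨ.intervalIntegrable_comp hm hC)]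
  refine Finset.sum_le_sum fun k _ => ?_
  have hlt : (k : ℝ) / 2 ^ n < (k + 1) / 2 ^ n := by
    gcongr
    linarith
  have hJ := hΨ.convexOn.map_intervalAverage_le hΨ.continuous hlt
    (hm.intervalIntegrable_of_norm_le hC _ _) (hΨ.intervalIntegrable_comp hm hC _ _)
  have hl : ((k : ℝ) + 1) / 2 ^ n - k / 2 ^ n = 1 / 2 ^ n := by ring
  rw [hh, hl, one_div, inv_inv] at hJ
  rw [integral_comp_dyadicSlope, smul_eq_mul, one_div]
  exact hJ

theorem UniformlyConvexOnBalls.dyadicSlope_cauchy {Ψ : E → ℝ} (hΨ : UniformlyConvexOnBalls Ψ)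
    {K : ℝ≥0} {f : ℝ → E} (hf : LipschitzWith K f) {ε : ℝ} (hε : 0 < ε) :
    ∃ N, ∀ n ≥ N, ∀ m ≥ n, ∫ x in (0 : ℝ)..1, ‖dyadicSlope f n x - dyadicSlope f m x‖ < ε := by
  set a : ℕ → ℝ := fun n => ∫ x in (0 : ℝ)..1, Ψ (dyadicSlope f n x) with ha
  have hm := stronglyMeasurable_dyadicSlope f
  have hK := norm_dyadicSlope_le hf
  have hmono : Monotone a := fun n m hnm =>
    hΨ.integral_dyadicSlope_le hf n (hm m) (hK m) (integral_dyadicSlope_of_le hf hnm)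
  have hbdd : BddAbove (Set.range a) := by
    obtain ⟨B, hB⟩ := hΨ.bounded K
    refine ⟨B, ?_⟩
    rintro _ ⟨n, rfl⟩
    have := intervalIntegral.norm_integral_le_of_norm_le_const (a := (0 : ℝ)) (b := 1) (C := B)
      (f := fun x => Ψ (dyadicSlope f n x)) (fun x _ => hB _ (hK n x))
    rw [sub_zero, abs_one, mul_one] at this
    exact (le_abs_self _).trans this
  have hcau : CauchySeq a := (tendsto_atTop_ciSup hmono hbdd).cauchySeq
  obtain ⟨C, hC⟩ := hΨ.modulus K (ε / 2) (half_pos hε)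
  -- The integrated gap will be at most `(a m - a n) / 2`, so this tolerance keeps its contribution
  -- below `ε / 2`, whatever the sign of `C`.
  obtain ⟨N, hN⟩ := Metric.cauchySeq_iff.1 hcau (ε / (|C| + 1)) (by positivity)
  refine ⟨N, fun n hn m hnm => ?_⟩
  set M : ℝ → E := fun x => (1 / 2 : ℝ) • (dyadicSlope f n x + dyadicSlope f m x) with hM
  have hMm : StronglyMeasurable M := ((hm n).add (hm m)).const_smul _
  have hMK : ∀ x, ‖M x‖ ≤ K := fun x => by
    have := norm_add_le (dyadicSlope f n x) (dyadicSlope f m x)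
    have h1 := hK n x
    have h2 := hK m x
    simp only [hM]
    rw [norm_smul, Real.norm_of_nonneg (by norm_num)]
    linarith
  -- The midpoint has the same level-`n` averages as the slope at level `n`. So the integral of `Ψ ∘
  -- M` is at least `a n`, and the gap is at most `(a n + a m) / 2 - a n`.
  have hMi : a n ≤ ∫ x in (0 : ℝ)..1, Ψ (M x) := by
    refine hΨ.integral_dyadicSlope_le hf n hMm hMK fun k => ?_
    rw [intervalIntegral.integral_smul, intervalIntegral.integral_add
      ((hm n).intervalIntegrable_of_norm_le (hK n) _ _)
      ((hm m).intervalIntegrable_of_norm_le (hK m) _ _), integral_dyadicSlope_of_le hf le_rfl,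
      integral_dyadicSlope_of_le hf hnm, ← two_smul ℝ, smul_smul]
    norm_num
  have hin := hΨ.intervalIntegrable_comp (hm n) (hK n) 0 1
  have him := hΨ.intervalIntegrable_comp (hm m) (hK m) 0 1
  have hiM := hΨ.intervalIntegrable_comp hMm hMK 0 1
  have hdi : IntervalIntegrable (fun x => ‖dyadicSlope f n x - dyadicSlope f m x‖) volume 0 1 :=
    (((hm n).intervalIntegrable_of_norm_le (hK n) _ _).sub
      ((hm m).intervalIntegrable_of_norm_le (hK m) _ _)).norm
  have hgi := ((hin.add him).div_const 2).sub hiM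
  have hle : ∫ x in (0 : ℝ)..1, ‖dyadicSlope f n x - dyadicSlope f m x‖
      ≤ ∫ x in (0 : ℝ)..1, (ε / 2 + C * ((Ψ (dyadicSlope f n x) + Ψ (dyadicSlope f m x)) / 2
        - Ψ (M x))) :=
    intervalIntegral.integral_mono_on zero_le_one hdi
      (intervalIntegrable_const.add (hgi.const_mul C)) fun x _ => hC _ _ (hK n x) (hK m x)
  rw [intervalIntegral.integral_add intervalIntegrable_const (hgi.const_mul C),
    intervalIntegral.integral_const_mul, intervalIntegral.integral_sub
      ((hin.add him).div_const 2) hiM, intervalIntegral.integral_const] at hle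
  simp_rw [intervalIntegral.integral_div, intervalIntegral.integral_add hin him] at hle
  have hconv : ∫ x in (0 : ℝ)..1, Ψ (M x) ≤ (a n + a m) / 2 := by
    have : ∫ x in (0 : ℝ)..1, Ψ (M x) ≤
        ∫ x in (0 : ℝ)..1, (Ψ (dyadicSlope f n x) + Ψ (dyadicSlope f m x)) / 2 :=
      intervalIntegral.integral_mono_on zero_le_one hiM ((hin.add him).div_const 2) fun x _ => by
        have := hΨ.convexOn.2 (Set.mem_univ (dyadicSlope f n x)) (Set.mem_univ (dyadicSlope f m x))
          (show (0 : ℝ) ≤ 1 / 2 by norm_num) (show (0 : ℝ) ≤ 1 / 2 by norm_num) (by norm_num)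
        rw [← smul_add, smul_eq_mul, smul_eq_mul] at this
        simp only [hM]
        linarith
    rwa [intervalIntegral.integral_div, intervalIntegral.integral_add hin him] at this
  have hd : |a n - a m| < ε / (|C| + 1) := hN n hn m (hn.trans hnm)
  have hnm' := hmono hnm
  rw [abs_sub_comm, abs_of_nonneg (sub_nonneg.2 hnm'), lt_div_iff₀ (by positivity)] at hd
  have hgap : C * ((a n + a m) / 2 - ∫ x in (0 : ℝ)..1, Ψ (M x)) ≤ |C| * ((a m - a n) / 2) := by
    refine (mul_le_mul_of_nonneg_right (le_abs_self C) (sub_nonneg.2 hconv)).trans ?_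
    exact mul_le_mul_of_nonneg_left (by linarith) (abs_nonneg C)
  rw [sub_zero, one_smul] at hle
  simp only [ha] at hgap hd hnm'
  nlinarith

theorem UniformlyConvexOnBalls.exists_integral_eq {Ψ : E → ℝ} (hΨ : UniformlyConvexOnBalls Ψ)
    {K : ℝ≥0} {f : ℝ → E} (hf : LipschitzWith K f) :
    ∃ g : ℝ → E, IntervalIntegrable g volume 0 1 ∧
      ∀ t ∈ Set.Icc (0 : ℝ) 1, ∫ x in (0 : ℝ)..t, g x = f t - f 0 := by
  set μ := (volume : Measure ℝ).restrict (Set.Ioc 0 1) with hμ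
  have hm := stronglyMeasurable_dyadicSlope f
  have hK := norm_dyadicSlope_le hf
  have hi : ∀ n, Integrable (dyadicSlope f n) μ := fun n =>
    (intervalIntegrable_iff_integrableOn_Ioc_of_le zero_le_one).1
      ((hm n).intervalIntegrable_of_norm_le (hK n) 0 1)
  have hcau : CauchySeq fun n => (hi n).toL1 := by
    rw [Metric.cauchySeq_iff']
    intro ε hε
    obtain ⟨N, hN⟩ := hΨ.dyadicSlope_cauchy hf hε
    refine ⟨N, fun n hn => ?_⟩
    rw [dist_comm, dist_eq_norm, ← Integrable.toL1_sub, L1.norm_of_fun_eq_integral_norm]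
    have := hN N le_rfl n hn
    rwa [intervalIntegral.integral_of_le zero_le_one] at this
  obtain ⟨g, hg⟩ := cauchySeq_tendsto_of_complete hcau
  have hgi : Integrable g μ := L1.integrable_coeFn g
  refine ⟨g, (intervalIntegrable_iff_integrableOn_Ioc_of_le zero_le_one).2 hgi, fun t ht => ?_⟩
  have hlim : Tendsto (fun n => ∫ x in (0 : ℝ)..t, dyadicSlope f n x) atTop
      (𝓝 (∫ x in (0 : ℝ)..t, g x)) := by
    have h1 : Tendsto (fun n => eLpNorm (dyadicSlope f n - (g : ℝ → E)) 1 μ) atTop (𝓝 0) := by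
      refine ((Lp.tendsto_Lp_iff_tendsto_eLpNorm' _ _).1 hg).congr fun n => ?_
      exact eLpNorm_congr_ae ((hi n).coeFn_toL1.sub (ae_eq_refl _))
    have h2 := tendsto_setIntegral_of_L1' g hgi.aestronglyMeasurable (Eventually.of_forall hi) h1
      (Set.Ioc 0 t)
    have h3 : μ.restrict (Set.Ioc 0 t) = volume.restrict (Set.Ioc 0 t) := by
      rw [hμ, Measure.restrict_restrict measurableSet_Ioc,
        Set.inter_eq_left.2 (Set.Ioc_subset_Ioc_right ht.2)]
    rw [h3] at h2
    simpa only [intervalIntegral.integral_of_le ht.1] using h2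
  refine tendsto_nhds_unique hlim ?_
  rw [tendsto_iff_norm_sub_tendsto_zero]
  -- At the level-`n` dyadic point just below `t` the identity is exact. Moving from there to `t`
  -- changes the integral and `f` by at most `K / 2 ^ n` each.
  have hz : Tendsto (fun n : ℕ => 2 * (K : ℝ) * (1 / 2) ^ n) atTop (𝓝 0) := by
    simpa using (tendsto_pow_atTop_nhds_zero_of_lt_one (r := (1 / 2 : ℝ)) (by norm_num)
      (by norm_num)).const_mul (2 * (K : ℝ))
  refine squeeze_zero (fun n => norm_nonneg _) (fun n => ?_) hz
  set k := ⌊(2 : ℝ) ^ n * t⌋₊ with hk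
  have h2 : (0 : ℝ) < 2 ^ n := by positivity
  have hk1 : (k : ℝ) / 2 ^ n ≤ t := by
    rw [div_le_iff₀ h2, mul_comm]
    exact Nat.floor_le (mul_nonneg h2.le ht.1)
  have hk2 : t - k / 2 ^ n ≤ (1 / 2) ^ n := by
    have := (Nat.lt_floor_add_one ((2 : ℝ) ^ n * t)).le
    rw [sub_le_iff_le_add, one_div, inv_pow, ← one_div, ← add_div, le_div_iff₀ h2]
    linarith
  have hII := fun a b => (hm n).intervalIntegrable_of_norm_le (hK n) a b
  have h3 := integral_dyadicSlope hf n (Nat.zero_le k)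
  simp only [Nat.cast_zero, zero_div] at h3
  have h4 := intervalIntegral.integral_add_adjacent_intervals (hII 0 (k / 2 ^ n))
    (hII (k / 2 ^ n) t)
  have h5 : ‖∫ x in ((k : ℝ) / 2 ^ n)..t, dyadicSlope f n x‖ ≤ K * |t - k / 2 ^ n| :=
    intervalIntegral.norm_integral_le_of_norm_le_const fun x _ => hK n x
  have h6 : ‖f t - f (k / 2 ^ n)‖ ≤ K * |t - k / 2 ^ n| := by
    simpa [dist_eq_norm] using hf.dist_le_mul t (k / 2 ^ n)
  rw [abs_of_nonneg (sub_nonneg.2 hk1)] at h5 h6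
  have h7 : (∫ x in (0 : ℝ)..t, dyadicSlope f n x) - (f t - f 0)
      = (∫ x in ((k : ℝ) / 2 ^ n)..t, dyadicSlope f n x) - (f t - f (k / 2 ^ n)) := by
    rw [← h4, h3]
    abel
  rw [h7]
  refine (norm_sub_le _ _).trans ?_
  nlinarith [mul_le_mul_of_nonneg_left hk2 K.2]

/-- Lipschitz curves in a Banach space that carries a function which is uniformly convex on balls
are almost everywhere differentiable. -/
theorem UniformlyConvexOnBalls.ae_differentiableAt {Ψ : E → ℝ} (hΨ : UniformlyConvexOnBalls Ψ)
    (K : ℝ≥0) (f : ℝ → E) (hf : LipschitzWith K f) : ∀ᵐ x : ℝ, DifferentiableAt ℝ f x := by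
  have key : ∀ (f : ℝ → E), LipschitzWith K f →
      ∀ᵐ x : ℝ, x ∈ Set.Ioo (0 : ℝ) 1 → DifferentiableAt ℝ f x := by
    intro f hf
    obtain ⟨g, hgi, hg⟩ := hΨ.exists_integral_eq hf
    filter_upwards [hgi.ae_hasDerivAt_integral] with x hx hxI
    have h1 := hx (by rw [Set.uIcc_of_le zero_le_one]; exact Set.Ioo_subset_Icc_self hxI) 0
      (by simp)
    refine (h1.add_const (f 0)).differentiableAt.congr_of_eventuallyEq ?_
    filter_upwards [isOpen_Ioo.mem_nhds hxI] with y hy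
    rw [hg y (Set.Ioo_subset_Icc_self hy), sub_add_cancel]
  -- Integer translates of `(0, 1)` cover the line up to the null set of integers.
  have hz : ∀ᵐ x : ℝ, ∀ z : ℤ, x - z ∈ Set.Ioo (0 : ℝ) 1 → DifferentiableAt ℝ f x := by
    rw [ae_all_iff]
    intro z
    have hfz : LipschitzWith K fun u => f (z + u) := by
      simpa [Function.comp_def] using hf.comp (isometry_add_left (z : ℝ)).lipschitz
    filter_upwards [(measurePreserving_sub_right volume (z : ℝ)).quasiMeasurePreserving.ae
      (key _ hfz)] with x hx hxI
    rw [differentiableAt_iff_comp_const_add (b := (z : ℝ)), neg_add_eq_sub]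
    exact hx hxI
  filter_upwards [hz, (Set.countable_range ((↑) : ℤ → ℝ)).ae_notMem volume] with x hx hxz
  refine hx ⌊x⌋ ⟨?_, ?_⟩
  · exact sub_pos.2 (lt_of_le_of_ne (Int.floor_le x) fun h => hxz ⟨_, h⟩)
  · linarith [Int.lt_floor_add_one x]

end DyadicMartingale

/-! ### Uniform convexity of powers of the norm -/

section PowerModulus

variable {E : Type*} [NormedAddCommGroup E] [NormedSpace ℝ E]

/-- The gap in the midpoint convexity inequality for `‖·‖ ^ p` controls `‖u - v‖ ^ p`, up to a
small multiple of `‖u‖ ^ p + ‖v‖ ^ p`. -/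
def HasPowerModulus (E : Type*) [NormedAddCommGroup E] [NormedSpace ℝ E] (p : ℝ) : Prop :=
  ∀ ε : ℝ, 0 < ε → ∃ C : ℝ, 0 ≤ C ∧ ∀ u v : E,
    ‖u - v‖ ^ p ≤ ε * (‖u‖ ^ p + ‖v‖ ^ p)
      + C * ((‖u‖ ^ p + ‖v‖ ^ p) / 2 - ‖(1 / 2 : ℝ) • (u + v)‖ ^ p)

theorem convexOn_norm_rpow {p : ℝ} (hp : 1 ≤ p) :
    ConvexOn ℝ Set.univ (fun u : E => ‖u‖ ^ p) := by
  refine ⟨convex_univ, fun x _ y _ a b ha hb hab => ?_⟩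
  have h1 : ‖a • x + b • y‖ ≤ a * ‖x‖ + b * ‖y‖ := by
    simpa using convexOn_univ_norm.2 (Set.mem_univ x) (Set.mem_univ y) ha hb hab
  have h2 := (convexOn_rpow hp).2 (norm_nonneg x) (norm_nonneg y) ha hb hab
  exact (Real.rpow_le_rpow (norm_nonneg _) h1 (by linarith)).trans h2

theorem midpoint_norm_rpow_le {p : ℝ} (hp : 1 ≤ p) (u v : E) :
    ‖(1 / 2 : ℝ) • (u + v)‖ ^ p ≤ (‖u‖ ^ p + ‖v‖ ^ p) / 2 := by
  have := (convexOn_norm_rpow hp).2 (Set.mem_univ u) (Set.mem_univ v)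
    (show (0 : ℝ) ≤ 1 / 2 by norm_num) (show (0 : ℝ) ≤ 1 / 2 by norm_num) (by norm_num)
  rw [← smul_add, smul_eq_mul, smul_eq_mul] at this
  linarith

theorem midpoint_norm_rpow_lt [StrictConvexSpace ℝ E] {p : ℝ} (hp : 1 < p) {u v : E}
    (huv : u ≠ v) : ‖(1 / 2 : ℝ) • (u + v)‖ ^ p < (‖u‖ ^ p + ‖v‖ ^ p) / 2 := by
  have hp0 : 0 < p := by linarith
  by_cases h : ‖u‖ = ‖v‖
  · have h1 := Real.rpow_lt_rpow (norm_nonneg _) ((norm_midpoint_lt_iff h).2 huv) hp0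
    rw [← h]
    linarith
  · have h1 := (strictConvexOn_rpow hp).2 (norm_nonneg u) (norm_nonneg v) h
      (show (0 : ℝ) < 1 / 2 by norm_num) (show (0 : ℝ) < 1 / 2 by norm_num) (by norm_num)
    have h2 : ‖(1 / 2 : ℝ) • (u + v)‖ ≤ (1 / 2 : ℝ) • ‖u‖ + (1 / 2 : ℝ) • ‖v‖ := by
      rw [norm_smul, Real.norm_of_nonneg (by norm_num), smul_eq_mul, smul_eq_mul, ← mul_add]
      exact mul_le_mul_of_nonneg_left (norm_add_le u v) (by norm_num)
    have h3 := Real.rpow_le_rpow (norm_nonneg _) h2 hp0.le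
    simp only [smul_eq_mul] at h1 h3
    linarith

/-- Both sides are homogeneous of degree `p`, so the unit sphere of `E × E` suffices. On its compact
part where `‖u - v‖ ^ p` is not already absorbed by the `ε` term, `u ≠ v`, so strict convexity gives
the gap a positive minimum. -/
theorem hasPowerModulus_of_strictConvexSpace [ProperSpace E] [StrictConvexSpace ℝ E] {p : ℝ}
    (hp : 1 < p) : HasPowerModulus E p := by
  intro ε hε
  have hp0 : 0 < p := by linarith
  have hcn : ∀ φ : E × E → E, Continuous φ → Continuous fun z => ‖φ z‖ ^ p := fun φ hφ =>
    hφ.norm.rpow_const fun _ => Or.inr hp0.le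
  set S : E × E → ℝ := fun z => ‖z.1‖ ^ p + ‖z.2‖ ^ p with hS
  set D : E × E → ℝ := fun z => S z / 2 - ‖(1 / 2 : ℝ) • (z.1 + z.2)‖ ^ p with hD
  have hSc : Continuous S := (hcn _ continuous_fst).add (hcn _ continuous_snd)
  have hDc : Continuous D := (hSc.div_const 2).sub
    (hcn _ ((continuous_fst.add continuous_snd).const_smul (1 / 2 : ℝ)))
  have hdc : Continuous fun z : E × E => ‖z.1 - z.2‖ ^ p := hcn _ (continuous_fst.sub continuous_snd)
  have hD0 : ∀ z, 0 ≤ D z := fun z => sub_nonneg.2 (midpoint_norm_rpow_le hp.le z.1 z.2)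
  set T : Set (E × E) := Metric.sphere 0 1 ∩ {z | ε * S z ≤ ‖z.1 - z.2‖ ^ p} with hT
  have hTc : IsCompact T :=
    (isCompact_sphere _ _).inter_right (isClosed_le (hSc.const_mul ε |>.congr fun _ => rfl) hdc)
  have hunit : ∃ C : ℝ, 0 ≤ C ∧ ∀ z ∈ Metric.sphere (0 : E × E) 1,
      ‖z.1 - z.2‖ ^ p ≤ ε * S z + C * D z := by
    rcases T.eq_empty_or_nonempty with hTe | hTn
    · refine ⟨0, le_rfl, fun z hz => ?_⟩
      by_contra! h
      have : z ∈ T := ⟨hz, by simp at h; exact h.le⟩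
      simp [hTe] at this
    · obtain ⟨z₀, hz₀, hmin⟩ := hTc.exists_isMinOn hTn hDc.continuousOn
      have hδ : 0 < D z₀ := by
        have hne : z₀.1 ≠ z₀.2 := by
          intro h
          have h1 : ε * S z₀ ≤ 0 := by simpa [h, hp0.ne'] using hz₀.2
          have h2 : S z₀ ≤ 0 := by nlinarith
          have h3 : 0 ≤ ‖z₀.1‖ ^ p := by positivity
          have h4 : 0 ≤ ‖z₀.2‖ ^ p := by positivity
          have h5 : ‖z₀.1‖ ^ p = 0 := by simp only [hS] at h2; linarith
          rw [Real.rpow_eq_zero (norm_nonneg _) hp0.ne', norm_eq_zero] at h5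
          have h6 : z₀ = 0 := Prod.ext h5 (h ▸ h5)
          have h7 := hz₀.1
          simp [h6] at h7
        exact sub_pos.2 (midpoint_norm_rpow_lt hp hne)
      -- In the sup norm of `E × E`, unit pairs satisfy `‖u - v‖ ≤ 2`, and `D z₀` is the least gap
      -- on `T`.
      refine ⟨2 ^ p / D z₀, by positivity, fun z hz => ?_⟩
      have hS0 : 0 ≤ S z := by simp only [hS]; positivity
      by_cases hzT : ε * S z ≤ ‖z.1 - z.2‖ ^ p
      · have h1 : D z₀ ≤ D z := hmin ⟨hz, hzT⟩
        have h2 : ‖z.1 - z.2‖ ≤ 2 := by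
          have h3 := norm_sub_le z.1 z.2
          have h4 := norm_fst_le z
          have h5 := norm_snd_le z
          rw [mem_sphere_zero_iff_norm.1 hz] at h4 h5
          linarith
        have h6 := Real.rpow_le_rpow (norm_nonneg _) h2 hp0.le
        have h7 : (2 : ℝ) ^ p ≤ 2 ^ p / D z₀ * D z := by
          rw [div_mul_eq_mul_div, le_div_iff₀ hδ]
          exact mul_le_mul_of_nonneg_left h1 (by positivity)
        have h8 : 0 ≤ ε * S z := by positivity
        linarith
      · push Not at hzT
        have : 0 ≤ 2 ^ p / D z₀ * D z := mul_nonneg (by positivity) (hD0 z)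
        linarith
  obtain ⟨C, hC0, hC⟩ := hunit
  refine ⟨C, hC0, fun u v => ?_⟩
  by_cases hz : ((u, v) : E × E) = 0
  · obtain ⟨rfl, rfl⟩ := Prod.mk.inj hz
    simp [hp0.ne']
  · set r := ‖((u, v) : E × E)‖ with hr
    have hr0 : 0 < r := norm_pos_iff.2 hz
    have h1 := hC (r⁻¹ • (u, v)) (by
      rw [mem_sphere_zero_iff_norm, norm_smul, norm_inv, norm_norm, inv_mul_cancel₀ hr0.ne'])
    have hsc : ∀ x : E, ‖r⁻¹ • x‖ ^ p = (r⁻¹) ^ p * ‖x‖ ^ p := fun x => by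
      rw [norm_smul, Real.norm_of_nonneg (by positivity),
        Real.mul_rpow (by positivity) (norm_nonneg _)]
    simp only [hD, hS, Prod.smul_fst, Prod.smul_snd, ← smul_sub, ← smul_add,
      smul_comm (1 / 2 : ℝ) r⁻¹, hsc] at h1
    have hrp : 0 < (r⁻¹) ^ p := by positivity
    refine le_of_mul_le_mul_left (h1.trans_eq ?_) hrp
    ring

theorem le_add_rpow_div {p ε t : ℝ} (hp : 1 ≤ p) (hε : 0 < ε) (ht : 0 ≤ t) :
    t ≤ ε + t ^ p * (ε / ε ^ p) := by
  rcases le_total t ε with h | h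
  · have : 0 ≤ t ^ p * (ε / ε ^ p) := by positivity
    linarith
  · have h1 : t / ε ≤ (t / ε) ^ p := Real.self_le_rpow_of_one_le ((one_le_div hε).2 h) hp
    rw [Real.div_rpow ht hε.le, div_le_iff₀ hε] at h1
    calc t ≤ t ^ p / ε ^ p * ε := h1
      _ = t ^ p * (ε / ε ^ p) := by ring
      _ ≤ _ := by linarith

theorem HasPowerModulus.uniformlyConvexOnBalls {p : ℝ} (hp : 1 ≤ p) (h : HasPowerModulus E p) :
    UniformlyConvexOnBalls fun u : E => ‖u‖ ^ p where
  continuous := continuous_norm.rpow_const fun _ => Or.inr (by linarith)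
  convexOn := convexOn_norm_rpow hp
  bounded R := ⟨|R| ^ p, fun u hu => by
    rw [abs_of_nonneg (by positivity)]
    exact Real.rpow_le_rpow (norm_nonneg _) (hu.trans (le_abs_self R)) (by linarith)⟩
  modulus R ε hε := by
    have hp0 : 0 ≤ p := by linarith
    set e := ε / 2 with he
    have he0 : 0 < e := half_pos hε
    set B := |R| ^ p with hB
    have hB0 : 0 ≤ B := by positivity
    -- On the ball `‖u‖ ^ p + ‖v‖ ^ p ≤ 2 * B`, so the error term is at most `e ^ p`, which the
    -- factor `e / e ^ p` turns into `e`. The `+ 1` covers `B = 0`.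
    obtain ⟨C, -, hC⟩ := h (e ^ p / (2 * B + 1)) (by positivity)
    refine ⟨C * (e / e ^ p), fun u v hu hv => ?_⟩
    have hu' : ‖u‖ ^ p ≤ B :=
      Real.rpow_le_rpow (norm_nonneg _) (hu.trans (le_abs_self R)) hp0
    have hv' : ‖v‖ ^ p ≤ B :=
      Real.rpow_le_rpow (norm_nonneg _) (hv.trans (le_abs_self R)) hp0
    have h1 := le_add_rpow_div hp he0 (norm_nonneg (u - v))
    have h2 := mul_le_mul_of_nonneg_right (hC u v) (show 0 ≤ e / e ^ p by positivity)
    have hep : 0 < e ^ p := by positivity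
    have h3 : e ^ p / (2 * B + 1) * (‖u‖ ^ p + ‖v‖ ^ p) ≤ e ^ p := by
      rw [div_mul_eq_mul_div, div_le_iff₀ (by positivity)]
      exact mul_le_mul_of_nonneg_left (by linarith) hep.le
    have h4 := mul_le_mul_of_nonneg_right h3 (show 0 ≤ e / e ^ p by positivity)
    have h5 : e ^ p * (e / e ^ p) = e := by field_simp
    have h6 : ε = e + e := (add_halves ε).symm
    rw [add_mul] at h2
    rw [h6]
    linarith

theorem MeasureTheory.Lp.norm_rpow_eq_integral {X F : Type*} [MeasurableSpace X]
    [NormedAddCommGroup F] {μ : Measure X} {p : ℝ≥0∞} (hp0 : p ≠ 0) (hp : p ≠ ∞)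
    (f : Lp F p μ) : ‖f‖ ^ p.toReal = ∫ x, ‖f x‖ ^ p.toReal ∂μ := by
  have h := (Lp.memLp f).eLpNorm_eq_integral_rpow_norm hp0 hp
  have hpos := ENNReal.toReal_pos hp0 hp
  have hi : 0 ≤ ∫ x, ‖f x‖ ^ p.toReal ∂μ := integral_nonneg fun x => by positivity
  rw [Lp.norm_def, h, ENNReal.toReal_ofReal (by positivity), ← Real.rpow_mul hi,
    inv_mul_cancel₀ hpos.ne', Real.rpow_one]

/-- The inequality is linear in the `p`-th powers of norms, so it integrates pointwise with the same
`C`. The error term has the form `ε * (‖u‖ ^ p + ‖v‖ ^ p)` because a constant would not be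
integrable on an infinite measure space. -/
theorem HasPowerModulus.lp {X : Type*} [MeasurableSpace X] (μ : Measure X) {p : ℝ≥0∞}
    [Fact (1 ≤ p)] (hp : p ≠ ∞) (h : HasPowerModulus E p.toReal) :
    HasPowerModulus (Lp E p μ) p.toReal := by
  intro ε hε
  obtain ⟨C, hC0, hC⟩ := h ε hε
  have hp0 : p ≠ 0 := (zero_lt_one.trans_le Fact.out).ne'
  refine ⟨C, hC0, fun u v => ?_⟩
  have hi : ∀ w : Lp E p μ, Integrable (fun x => ‖w x‖ ^ p.toReal) μ := fun w =>
    (Lp.memLp w).integrable_norm_rpow hp0 hp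
  have hsum : Integrable (fun x => ‖u x‖ ^ p.toReal + ‖v x‖ ^ p.toReal) μ := (hi u).add (hi v)
  have hhalf : Integrable (fun x => (‖u x‖ ^ p.toReal + ‖v x‖ ^ p.toReal) / 2) μ :=
    hsum.div_const 2
  have hgap : Integrable (fun x => (‖u x‖ ^ p.toReal + ‖v x‖ ^ p.toReal) / 2
      - ‖((1 / 2 : ℝ) • (u + v)) x‖ ^ p.toReal) μ := hhalf.sub (hi _)
  simp only [Lp.norm_rpow_eq_integral hp0 hp]
  rw [← integral_add (hi u) (hi v), ← integral_div, ← integral_sub hhalf (hi _),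
    ← integral_const_mul, ← integral_const_mul, ← integral_add (hsum.const_mul ε)
      (hgap.const_mul C)]
  refine integral_mono_ae (hi _) ((hsum.const_mul ε).add (hgap.const_mul C)) ?_
  filter_upwards [Lp.coeFn_sub u v, Lp.coeFn_add u v, Lp.coeFn_smul (1 / 2 : ℝ) (u + v)]
    with x h1 h2 h3
  simp only [h1, h3, h2, Pi.sub_apply, Pi.add_apply, Pi.smul_apply]
  exact hC (u x) (v x)

/-- By the parallelogram law the gap equals `‖u - v‖ ^ 2 / 4`. -/
theorem hasPowerModulus_two_of_innerProductSpace (𝕜 : Type*) [RCLike 𝕜] [InnerProductSpace 𝕜 E] :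
    HasPowerModulus E 2 := by
  intro ε hε
  refine ⟨4, by norm_num, fun u v => ?_⟩
  have h := parallelogram_law_with_norm 𝕜 u v
  have h0 : 0 ≤ ε * (‖u‖ ^ 2 + ‖v‖ ^ 2) := by positivity
  simp only [Real.rpow_two, norm_smul, mul_pow]
  norm_num
  nlinarith

end PowerModulus

/-! ### Lipschitz curves in Hilbert spaces and in `L^p` -/

section Instances

theorem LipschitzWith.ae_differentiableAt_of_innerProductSpace (𝕜 : Type*) [RCLike 𝕜] {H : Type*}
    [NormedAddCommGroup H] [InnerProductSpace 𝕜 H] [CompleteSpace H] [NormedSpace ℝ H]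
    (K : ℝ≥0) (f : ℝ → H) (hf : LipschitzWith K f) : ∀ᵐ x : ℝ, DifferentiableAt ℝ f x :=
  ((hasPowerModulus_two_of_innerProductSpace 𝕜).uniformlyConvexOnBalls
    one_le_two).ae_differentiableAt K f hf

theorem LipschitzWith.ae_differentiableAt_of_Lp {𝕜 Y : Type*} [RCLike 𝕜] [MeasurableSpace Y]
    (ν : Measure Y) {p : ℝ≥0∞} [Fact (1 ≤ p)] (hp : 1 < p) (hp' : p ≠ ∞)
    (K : ℝ≥0) (f : ℝ → Lp 𝕜 p ν) (hf : LipschitzWith K f) :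
    ∀ᵐ x : ℝ, DifferentiableAt ℝ f x := by
  have h1 : 1 < p.toReal := by
    rw [← ENNReal.toReal_one]
    exact (ENNReal.toReal_lt_toReal ENNReal.one_ne_top hp').2 hp
  have h2 : HasPowerModulus 𝕜 p.toReal := hasPowerModulus_of_strictConvexSpace h1
  exact ((h2.lp ν hp').uniformlyConvexOnBalls h1.le).ae_differentiableAt K f hf

end Instances

/-! ### Jointly measurable representatives of `L^p`-valued maps -/

section JointRepresentatives

variable {𝕜 X Y : Type*} [RCLike 𝕜] [MeasurableSpace X] [MeasurableSpace Y] {ν : Measure Y}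
  {p : ℝ≥0∞}

theorem sectionLp_eq {G : ℝ × Y → 𝕜} {x : ℝ} {u : Lp 𝕜 p ν}
    (h : (fun y => G (x, y)) =ᵐ[ν] u) : sectionLp p ν G x = u := by
  have hm : MemLp (fun y => G (x, y)) p ν := (memLp_congr_ae h).2 (Lp.memLp u)
  rw [sectionLp, dif_pos hm]
  exact Lp.ext (hm.coeFn_toLp.trans h)

variable [Fact (1 ≤ p)]

theorem MeasureTheory.Lp.ae_tendsto_of_norm_sub_le {s : ℕ → Lp 𝕜 p ν} {g : Lp 𝕜 p ν}
    (h : ∀ n, ‖s n - g‖ ≤ (1 / 2) ^ n) : ∀ᵐ y ∂ν, Tendsto (fun n => s n y) atTop (𝓝 (g y)) := by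
  have hz : Tendsto (fun n : ℕ => ((1 / 2) ^ n : ℝ)) atTop (𝓝 0) :=
    tendsto_pow_atTop_nhds_zero_of_lt_one (by norm_num) (by norm_num)
  have hlim : Tendsto s atTop (𝓝 g) :=
    tendsto_iff_norm_sub_tendsto_zero.2 (squeeze_zero (fun n => norm_nonneg _) h hz)
  have hex : ∀ᵐ y ∂ν, ∃ l : 𝕜, Tendsto (fun n => s n y) atTop (𝓝 l) := by
    -- The geometric rate gives convergence of the whole sequence almost everywhere. Two errors sum
    -- to at most `2 * (1 / 2) ^ N`; the factor 3 makes the bound strict.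
    refine ae_tendsto_of_cauchy_eLpNorm (p := p) (fun n => Lp.aestronglyMeasurable (s n)) Fact.out
      (B := fun n => ENNReal.ofReal (3 * (1 / 2) ^ n))
      ((summable_geometric_two.mul_left 3).tsum_ofReal_ne_top) fun N n m hn hm => ?_
    have e : eLpNorm (s n - s m : Y → 𝕜) p ν = ENNReal.ofReal ‖s n - s m‖ := by
      rw [ofReal_norm, Lp.enorm_def]
      exact eLpNorm_congr_ae (Lp.coeFn_sub _ _).symm
    rw [e, ENNReal.ofReal_lt_ofReal_iff (by positivity)]
    have hpow : ∀ k, N ≤ k → ((1 / 2) ^ k : ℝ) ≤ (1 / 2) ^ N := fun k hk =>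
      pow_le_pow_of_le_one (by norm_num) (by norm_num) hk
    have h1 : ‖s n - s m‖ ≤ ‖s n - g‖ + ‖s m - g‖ := by
      rw [← sub_sub_sub_cancel_right (s n) (s m) g]
      exact norm_sub_le _ _
    have h2 := (h n).trans (hpow n hn)
    have h3 := (h m).trans (hpow m hm)
    have h4 : (0 : ℝ) < (1 / 2) ^ N := by positivity
    linarith
  have hmeas : TendstoInMeasure ν (fun n => (s n : Y → 𝕜)) atTop g :=
    tendstoInMeasure_of_tendsto_Lp hlim
  obtain ⟨ns, hns, hsub⟩ := hmeas.exists_seq_tendsto_ae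
  filter_upwards [hex, hsub] with y ⟨l, hl⟩ hy
  have : l = g y := tendsto_nhds_unique (hl.comp hns.tendsto_atTop) hy
  rwa [← this]

/-- A strongly measurable map into `L^p(Y)` is represented by a jointly measurable function. -/
theorem MeasureTheory.StronglyMeasurable.exists_joint_representative {g : X → Lp 𝕜 p ν}
    (hg : StronglyMeasurable g) :
    ∃ G : X × Y → 𝕜, StronglyMeasurable G ∧ ∀ x, (fun y => G (x, y)) =ᵐ[ν] g x := by
  classical
  obtain ⟨c, hc, hgc⟩ := hg.isSeparable_range
  obtain ⟨e, he⟩ := (hc.insert 0).exists_eq_range (Set.insert_nonempty 0 c)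
  have hex : ∀ (n : ℕ) (x : X), ∃ k, ‖e k - g x‖ < (1 / 2 : ℝ) ^ n := fun n x => by
    have h1 : g x ∈ closure (Set.range e) :=
      he ▸ closure_mono (Set.subset_insert 0 c) (hgc ⟨x, rfl⟩)
    obtain ⟨_, ⟨k, rfl⟩, hk⟩ := Metric.mem_closure_iff.1 h1 ((1 / 2 : ℝ) ^ n) (by positivity)
    refine ⟨k, ?_⟩
    rwa [← dist_eq_norm, dist_comm]
  -- Taking the least admissible index makes the approximation of `g x` within `(1 / 2) ^ n`
  -- measurable in `x`.
  have hN : ∀ n, Measurable fun x => Nat.find (hex n x) := fun n =>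
    measurable_find (hex n) fun k => StronglyMeasurable.measurableSet_lt
      (stronglyMeasurable_const.sub hg).norm stronglyMeasurable_const
  have hS : ∀ n, StronglyMeasurable fun z : X × Y => e (Nat.find (hex n z.1)) z.2 := fun n => by
    have h1 : Measurable fun z : ℕ × Y => e z.1 z.2 :=
      measurable_from_prod_countable_right fun k => (Lp.stronglyMeasurable (e k)).measurable
    exact (h1.comp (((hN n).comp measurable_fst).prodMk measurable_snd)).stronglyMeasurable
  refine ⟨_, StronglyMeasurable.limUnder (l := atTop) hS, fun x => ?_⟩
  filter_upwards [Lp.ae_tendsto_of_norm_sub_le fun n => (Nat.find_spec (hex n x)).le] with y hy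
  exact hy.limUnder_eq

theorem eLpNorm_joint_representative [SFinite ν] {μ : Measure X} (hp : p ≠ ∞) {g : X → Lp 𝕜 p ν}
    {G : X × Y → 𝕜} (hG : AEStronglyMeasurable G (μ.prod ν))
    (hGg : ∀ x, (fun y => G (x, y)) =ᵐ[ν] g x) :
    eLpNorm G p (μ.prod ν) = eLpNorm g p μ := by
  have hp0 : p ≠ 0 := (zero_lt_one.trans_le Fact.out).ne'
  have hpos := ENNReal.toReal_pos hp0 hp
  rw [eLpNorm_eq_lintegral_rpow_enorm_toReal hp0 hp, eLpNorm_eq_lintegral_rpow_enorm_toReal hp0 hp,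
    lintegral_prod _ (hG.enorm.pow_const _)]
  congr 1
  refine lintegral_congr fun x => ?_
  rw [Lp.enorm_def, ← eLpNorm_congr_ae (hGg x), eLpNorm_eq_lintegral_rpow_enorm_toReal hp0 hp,
    ← ENNReal.rpow_mul, one_div, inv_mul_cancel₀ hpos.ne', ENNReal.rpow_one]

theorem memLp_joint_representative [SFinite ν] {μ : Measure X} (hp : p ≠ ∞) {g : X → Lp 𝕜 p ν}
    {G : X × Y → 𝕜} (hG : StronglyMeasurable G)
    (hGg : ∀ x, (fun y => G (x, y)) =ᵐ[ν] g x) (hg : MemLp g p μ) : MemLp G p (μ.prod ν) :=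
  ⟨hG.aestronglyMeasurable,
    (eLpNorm_joint_representative hp hG.aestronglyMeasurable hGg).trans_lt hg.2⟩

end JointRepresentatives

/-! ### The functional on `L^q(ℝ × Y)` defined by a curve -/

section Pairing

variable {𝕜 Y : Type*} [RCLike 𝕜] [MeasurableSpace Y] {ν : Measure Y} {p q : ℝ≥0∞}

theorem ae_section_mul_eq {f : ℝ → Lp 𝕜 p ν} {F Φ : ℝ × Y → 𝕜} {x : ℝ}
    (hFf : ∀ x, (fun y => F (x, y)) =ᵐ[ν] f x) :
    (fun y => F (x, y) * Φ (x, y)) =ᵐ[ν] fun y => f x y * Φ (x, y) := by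
  filter_upwards [hFf x] with y hy
  rw [hy]

theorem pairingIntegral_eq_integral_prod [SigmaFinite ν] {f : ℝ → Lp 𝕜 p ν} {F Φ : ℝ × Y → 𝕜}
    (hFf : ∀ x, (fun y => F (x, y)) =ᵐ[ν] f x)
    (hi : Integrable (fun z => F z * Φ z) ((volume : Measure ℝ).prod ν)) :
    pairingIntegral f Φ = ∫ z, F z * Φ z ∂((volume : Measure ℝ).prod ν) := by
  rw [pairingIntegral, integral_prod _ hi]
  exact integral_congr_ae (Eventually.of_forall fun x =>
    (integral_congr_ae (ae_section_mul_eq hFf)).symm)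

variable [SigmaFinite ν] [Fact (1 ≤ p)]

theorem norm_lpPairing_mul_le {X : Type*} [MeasurableSpace X] {μ : Measure X} [Fact (1 ≤ q)]
    [p.HolderConjugate q] (F : Lp 𝕜 p μ) :
    ‖(ContinuousLinearMap.mul 𝕜 𝕜).lpPairing μ p q F‖ ≤ ‖F‖ := by
  refine ContinuousLinearMap.opNorm_le_bound _ (norm_nonneg _) fun Φ => ?_
  set B := ContinuousLinearMap.mul 𝕜 𝕜
  have h1 : B.lpPairing μ p q F Φ = ∫ x, B.holder 1 F Φ x ∂μ := by
    rw [B.lpPairing_eq_integral]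
    exact (integral_congr_ae (B.coeFn_holder F Φ)).symm
  rw [h1]
  calc ‖∫ x, B.holder 1 F Φ x ∂μ‖ ≤ ∫ x, ‖B.holder 1 F Φ x‖ ∂μ := norm_integral_le_integral_norm _
    _ = ‖B.holder 1 F Φ‖ := (L1.norm_eq_integral_norm _).symm
    _ ≤ ‖B‖ * ‖F‖ * ‖Φ‖ := B.norm_holder_apply_apply_le F Φ
    _ ≤ 1 * ‖F‖ * ‖Φ‖ := by
      gcongr
      exact ContinuousLinearMap.opNorm_mul_le 𝕜 𝕜
    _ = ‖F‖ * ‖Φ‖ := by rw [one_mul]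

theorem exists_continuousLinearMap_eq_pairingIntegral (hp : p ≠ ∞) [Fact (1 ≤ q)]
    [p.HolderConjugate q] {f : ℝ → Lp 𝕜 p ν} (hf : Continuous f) (hs : HasCompactSupport f) :
    ∃ L : Lp 𝕜 q ((volume : Measure ℝ).prod ν) →L[𝕜] 𝕜,
      (∀ Φ : Lp 𝕜 q ((volume : Measure ℝ).prod ν),
        (∀ᵐ x : ℝ, Integrable (fun y => f x y * Φ (x, y)) ν) ∧
        Integrable (fun x : ℝ => ∫ y, f x y * Φ (x, y) ∂ν) ∧
        L Φ = pairingIntegral f Φ) ∧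
      ‖L‖ ≤ (∫ x : ℝ, ‖f x‖ ^ p.toReal) ^ (1 / p.toReal) := by
  have hp0 : p ≠ 0 := (zero_lt_one.trans_le Fact.out).ne'
  obtain ⟨F, hF, hFf⟩ := hf.stronglyMeasurable.exists_joint_representative
  have hfp : MemLp f p volume := hf.memLp_of_hasCompactSupport hs
  have hFp := memLp_joint_representative hp hF hFf hfp
  refine ⟨(ContinuousLinearMap.mul 𝕜 𝕜).lpPairing _ p q (hFp.toLp F), fun Φ => ?_, ?_⟩
  · have hi : Integrable (fun z => F z * Φ z) ((volume : Measure ℝ).prod ν) :=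
      hFp.integrable_mul (Lp.memLp Φ)
    refine ⟨?_, ?_, ?_⟩
    · filter_upwards [hi.prod_right_ae] with x hx
      exact hx.congr (ae_section_mul_eq hFf)
    · exact hi.integral_prod_left.congr (Eventually.of_forall fun x =>
        integral_congr_ae (ae_section_mul_eq hFf))
    · rw [pairingIntegral_eq_integral_prod hFf hi, ContinuousLinearMap.lpPairing_eq_integral]
      refine integral_congr_ae ?_
      filter_upwards [hFp.coeFn_toLp] with z hz
      rw [hz, ContinuousLinearMap.mul_apply']
  · refine (norm_lpPairing_mul_le _).trans_eq ?_
    rw [Lp.norm_toLp, eLpNorm_joint_representative hp hF.aestronglyMeasurable hFf,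
      hfp.eLpNorm_eq_integral_rpow_norm hp0 hp, one_div, ENNReal.toReal_ofReal (by positivity)]

end Pairing

/-! ### Difference quotients and the joint derivative -/

section DifferenceQuotients

/-- Dominated convergence: the quotients and the derivative are bounded by `K`, and for `|h| ≤ 1`
they vanish outside the compact 1-thickening of the support. -/
theorem LipschitzWith.tendsto_eLpNorm_differenceQuotient_sub_deriv {E : Type*}
    [NormedAddCommGroup E] [NormedSpace ℝ E] [CompleteSpace E] {p : ℝ≥0∞} (hp0 : p ≠ 0)
    (hp : p ≠ ∞) {K : ℝ≥0} {f : ℝ → E} (hf : LipschitzWith K f) (hs : HasCompactSupport f)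
    (hd : ∀ᵐ x : ℝ, DifferentiableAt ℝ f x) :
    Tendsto (fun h : ℝ => eLpNorm (fun x => h⁻¹ • (f (x + h) - f x) - deriv f x) p volume)
      (𝓝[≠] 0) (𝓝 0) := by
  have hpos := ENNReal.toReal_pos hp0 hp
  set T := Metric.cthickening 1 (tsupport f) with hT
  have hTc : IsCompact T := hs.isCompact.cthickening
  have hquot : ∀ h x : ℝ, ‖h⁻¹ • (f (x + h) - f x)‖ ≤ K := fun h x => by
    rcases eq_or_ne h 0 with rfl | hh
    · simp
    · have := hf.dist_le_mul (x + h) x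
      rw [dist_eq_norm, Real.dist_eq, add_sub_cancel_left] at this
      rw [norm_smul, norm_inv, Real.norm_eq_abs, inv_mul_le_iff₀ (abs_pos.2 hh), mul_comm]
      exact this
  have hsupp : ∀ h x : ℝ, |h| ≤ 1 → x ∉ T → h⁻¹ • (f (x + h) - f x) - deriv f x = 0 := by
    intro h x hh hx
    have h1 : x ∉ tsupport f := fun hx' => hx (Metric.self_subset_cthickening _ hx')
    have h2 : x + h ∉ tsupport f := fun hx' =>
      hx (Metric.mem_cthickening_of_dist_le x (x + h) 1 _ hx' (by simpa [Real.dist_eq] using hh))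
    have h3 : deriv f x = 0 := by
      by_contra h3
      exact h1 (support_deriv_subset h3)
    rw [image_eq_zero_of_notMem_tsupport h1, image_eq_zero_of_notMem_tsupport h2, h3]
    simp
  have hmain : Tendsto (fun h : ℝ => ∫⁻ x, ‖h⁻¹ • (f (x + h) - f x) - deriv f x‖ₑ ^ p.toReal)
      (𝓝[≠] 0) (𝓝 (∫⁻ _ : ℝ, 0)) := by
    refine tendsto_lintegral_filter_of_dominated_convergence
      (T.indicator fun _ => (2 * K : ℝ≥0∞) ^ p.toReal) ?_ ?_ ?_ ?_
    · refine Eventually.of_forall fun h => ?_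
      have hc : Continuous fun x => h⁻¹ • (f (x + h) - f x) :=
        ((hf.continuous.comp (continuous_add_const h)).sub hf.continuous).const_smul _
      exact (hc.stronglyMeasurable.sub (stronglyMeasurable_deriv f)).enorm.pow_const _
    · have : ∀ᶠ h : ℝ in 𝓝[≠] 0, |h| ≤ 1 := by
        refine mem_nhdsWithin_of_mem_nhds ?_
        filter_upwards [Metric.closedBall_mem_nhds (0 : ℝ) one_pos] with h hh
        simpa using hh
      filter_upwards [this] with h hh
      refine Eventually.of_forall fun x => ?_
      by_cases hx : x ∈ T
      · rw [Set.indicator_of_mem hx]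
        gcongr
        have h1 := (_root_.norm_sub_le (h⁻¹ • (f (x + h) - f x)) (deriv f x)).trans
          (add_le_add (hquot h x) (norm_deriv_le_of_lipschitz hf))
        rw [← two_mul] at h1
        rw [← ofReal_norm]
        refine (ENNReal.ofReal_le_ofReal h1).trans_eq ?_
        rw [ENNReal.ofReal_mul zero_le_two, ENNReal.ofReal_coe_nnreal]
        simp
      · rw [Set.indicator_of_notMem hx, hsupp h x hh hx, enorm_zero,
          ENNReal.zero_rpow_of_pos hpos]
    · rw [lintegral_indicator_const hTc.measurableSet]
      exact ENNReal.mul_ne_top (ENNReal.rpow_ne_top_of_nonneg hpos.le (by finiteness))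
        hTc.measure_lt_top.ne
    · filter_upwards [hd] with x hx
      have h1 : Tendsto (fun h : ℝ => h⁻¹ • (f (x + h) - f x) - deriv f x) (𝓝[≠] 0) (𝓝 0) := by
        simpa using (hasDerivAt_iff_tendsto_slope_zero.1 hx.hasDerivAt).sub_const (deriv f x)
      have h2 := (ENNReal.continuous_rpow_const (y := p.toReal)).continuousAt.tendsto.comp
        h1.enorm
      simpa [Function.comp_def, ENNReal.zero_rpow_of_pos hpos] using h2
  rw [lintegral_zero] at hmain
  have h3 := (ENNReal.continuous_rpow_const (y := 1 / p.toReal)).continuousAt.tendsto.comp hmain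
  rw [ENNReal.zero_rpow_of_pos (by positivity)] at h3
  refine h3.congr fun h => ?_
  rw [eLpNorm_eq_lintegral_rpow_enorm_toReal hp0 hp]
  rfl

theorem LipschitzWith.memLp_deriv_of_hasCompactSupport {E : Type*} {p : ℝ≥0∞} [NormedAddCommGroup E]
    [NormedSpace ℝ E] [CompleteSpace E] {K : ℝ≥0} {f : ℝ → E} (hf : LipschitzWith K f)
    (hs : HasCompactSupport f) : MemLp (deriv f) p volume := by
  have h1 : MemLp (deriv f) p (volume.restrict (tsupport f)) := by
    have : IsFiniteMeasure (volume.restrict (tsupport f)) :=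
      isFiniteMeasure_restrict.2 hs.isCompact.measure_lt_top.ne
    exact MemLp.of_bound (stronglyMeasurable_deriv f).aestronglyMeasurable K
      (Eventually.of_forall fun x => norm_deriv_le_of_lipschitz hf)
  have h2 := (memLp_indicator_iff_restrict (isClosed_tsupport f).measurableSet).2 h1
  rwa [Set.indicator_eq_self.2 support_deriv_subset] at h2

variable {𝕜 Y : Type*} [RCLike 𝕜] [MeasurableSpace Y] {ν : Measure Y} [SigmaFinite ν]
  {p q : ℝ≥0∞} [Fact (1 ≤ p)]

/-- Passing to joint representatives preserves norms, so the quotients converge in the norm of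
`L^p(ℝ × Y)`, and the Hölder pairing with `Φ` is continuous. -/
theorem LipschitzWith.tendsto_pairingIntegral (hp : p ≠ ∞) [Fact (1 ≤ q)] [p.HolderConjugate q]
    {K : ℝ≥0} {f : ℝ → Lp 𝕜 p ν} (hf : LipschitzWith K f) (hs : HasCompactSupport f)
    (hd : ∀ᵐ x : ℝ, DifferentiableAt ℝ f x) {G : ℝ × Y → 𝕜} (hG : StronglyMeasurable G)
    (hGf : ∀ x, (fun y => G (x, y)) =ᵐ[ν] (deriv f x : Lp 𝕜 p ν)) {Φ : ℝ × Y → 𝕜}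
    (hΦ : MemLp Φ q ((volume : Measure ℝ).prod ν)) :
    Tendsto (fun h : ℝ => pairingIntegral (fun x => h⁻¹ • (f (x + h) - f x)) Φ)
      (𝓝[≠] 0) (𝓝 (∫ z, G z * Φ z ∂((volume : Measure ℝ).prod ν))) := by
  have hp0 : p ≠ 0 := (zero_lt_one.trans_le Fact.out).ne'
  set π := (volume : Measure ℝ).prod ν
  have hfc : Continuous f := hf.continuous
  have hc : ∀ h : ℝ, Continuous fun x => h⁻¹ • (f (x + h) - f x) := fun h =>
    Continuous.const_smul ((hfc.comp (continuous_add_const h)).sub hfc) h⁻¹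
  have hcs : ∀ h : ℝ, HasCompactSupport fun x => h⁻¹ • (f (x + h) - f x) := fun h =>
    ((hs.comp_homeomorph (Homeomorph.addRight h)).sub hs).comp_left (smul_zero h⁻¹)
  choose D hD hDf using fun h => (hc h).stronglyMeasurable.exists_joint_representative
  have hDp : ∀ h, MemLp (D h) p π := fun h => memLp_joint_representative hp (hD h) (hDf h)
    ((hc h).memLp_of_hasCompactSupport (hcs h))
  have hGp : MemLp G p π := memLp_joint_representative hp hG hGf
    (hf.memLp_deriv_of_hasCompactSupport hs)
  have hpair : ∀ {F : ℝ × Y → 𝕜} (hF : MemLp F p π),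
      (ContinuousLinearMap.mul 𝕜 𝕜).lpPairing π p q (hF.toLp F) (hΦ.toLp Φ)
        = ∫ z, F z * Φ z ∂π := fun hF => by
    rw [ContinuousLinearMap.lpPairing_eq_integral]
    refine integral_congr_ae ?_
    filter_upwards [hF.coeFn_toLp, hΦ.coeFn_toLp] with z h1 h2
    rw [h1, h2, ContinuousLinearMap.mul_apply']
  have hlim : Tendsto (fun h => (hDp h).toLp (D h)) (𝓝[≠] 0) (𝓝 (hGp.toLp G)) := by
    rw [Lp.tendsto_Lp_iff_tendsto_eLpNorm'']
    refine (hf.tendsto_eLpNorm_differenceQuotient_sub_deriv hp0 hp hs hd).congr fun h => ?_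
    refine (eLpNorm_joint_representative hp ((hD h).sub hG).aestronglyMeasurable fun x => ?_).symm
    filter_upwards [hDf h x, hGf x, Lp.coeFn_sub (h⁻¹ • (f (x + h) - f x)) (deriv f x)]
      with y h1 h2 h3
    rw [h3, Pi.sub_apply, Pi.sub_apply, h1, h2]
  have hcont : Continuous fun F : Lp 𝕜 p π =>
      (ContinuousLinearMap.mul 𝕜 𝕜).lpPairing π p q F (hΦ.toLp Φ) :=
    (ContinuousLinearMap.apply 𝕜 𝕜 (hΦ.toLp Φ)).continuous.comp
      ((ContinuousLinearMap.mul 𝕜 𝕜).lpPairing π p q).continuous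
  have := (hcont.tendsto (hGp.toLp G)).comp hlim
  rw [hpair hGp] at this
  refine this.congr fun h => ?_
  rw [Function.comp_apply, hpair (hDp h),
    pairingIntegral_eq_integral_prod (hDf h) ((hDp h).integrable_mul hΦ)]

theorem LipschitzWith.exists_joint_derivative (hp : 1 < p) (hp' : p ≠ ∞) [Fact (1 ≤ q)]
    [p.HolderConjugate q] {K : ℝ≥0} {f : ℝ → Lp 𝕜 p ν} (hf : LipschitzWith K f) :
    ∃ G : ℝ × Y → 𝕜,
      (∀ a b : ℝ, MemLp G p ((volume.restrict (Set.Icc a b)).prod ν)) ∧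
      (∀ r t : ℝ, r < t →
        IntervalIntegrable (sectionLp p ν G) volume r t ∧
        f t - f r = ∫ x in r..t, sectionLp p ν G x) ∧
      (∀ᵐ x : ℝ, HasDerivAt f (sectionLp p ν G x) x) ∧
      (HasCompactSupport f →
        MemLp G p ((volume : Measure ℝ).prod ν) ∧
        ∀ Φ : ℝ × Y → 𝕜, MemLp Φ q ((volume : Measure ℝ).prod ν) →
          Tendsto (fun h : ℝ => pairingIntegral (fun x => h⁻¹ • (f (x + h) - f x)) Φ)
            (𝓝[≠] 0) (𝓝 (∫ z, G z * Φ z ∂((volume : Measure ℝ).prod ν)))) := by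
  have hd := LipschitzWith.ae_differentiableAt_of_Lp ν hp hp' K f hf
  obtain ⟨G, hG, hGf⟩ := (stronglyMeasurable_deriv f).exists_joint_representative
  have hsec : sectionLp p ν G = deriv f := funext fun x => sectionLp_eq (hGf x)
  refine ⟨G, fun a b => ?_, fun r t _ => ?_, ?_, fun hs => ⟨?_, fun Φ hΦ => ?_⟩⟩
  · exact memLp_joint_representative hp' hG hGf
      (MemLp.of_bound (stronglyMeasurable_deriv f).aestronglyMeasurable K
        (Eventually.of_forall fun x => norm_deriv_le_of_lipschitz hf))
  · rw [hsec]
    exact ⟨hf.intervalIntegrable_deriv r t, (hf.integral_deriv_eq_sub_of_ae hd r t).symm⟩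
  · rw [hsec]
    filter_upwards [hd] with x hx using hx.hasDerivAt
  · exact memLp_joint_representative hp' hG hGf (hf.memLp_deriv_of_hasCompactSupport hs)
  · exact hf.tendsto_pairingIntegral hp' hs hd hG hGf hΦ

end DifferenceQuotients

/-! ### Lipschitz curves in `ℓ^s` -/

section SequenceSpaces

variable {𝕜 : Type*} [RCLike 𝕜] {s : ℝ≥0∞} [Fact (1 ≤ s)] {K : ℝ≥0}
  {f : ℝ → lp (fun _ : ℕ => 𝕜) s}

theorem LipschitzWith.lp_apply (hf : LipschitzWith K f) (j : ℕ) :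
    LipschitzWith K fun u => f u j := by
  refine LipschitzWith.of_dist_le_mul fun x y => ?_
  have hs : s ≠ 0 := (zero_lt_one.trans_le Fact.out).ne'
  refine le_trans ?_ (hf.dist_le_mul x y)
  rw [dist_eq_norm, dist_eq_norm]
  exact lp.norm_apply_le_norm hs (f x - f y) j

theorem LipschitzWith.ae_differentiableAt_lp_apply (hf : LipschitzWith K f) :
    ∀ᵐ x : ℝ, ∀ j : ℕ, DifferentiableAt ℝ (fun u => f u j) x :=
  ae_all_iff.2 fun j =>
    LipschitzWith.ae_differentiableAt_of_innerProductSpace 𝕜 K _ (hf.lp_apply j)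

/-- The difference quotients lie in the ball of radius `K`, which is closed under coordinatewise
limits, also for `s = ∞`. -/
theorem LipschitzWith.exists_lp_hasDerivAt_apply (hf : LipschitzWith K f) {x : ℝ}
    (hx : ∀ j : ℕ, DifferentiableAt ℝ (fun u => f u j) x) :
    ∃ v : lp (fun _ : ℕ => 𝕜) s, (∀ j : ℕ, HasDerivAt (fun u => f u j) (v j) x) ∧ ‖v‖ ≤ K := by
  set D : ℕ → lp (fun _ : ℕ => 𝕜) s := fun n =>
    ((1 : ℝ) / (n + 1))⁻¹ • (f (x + 1 / (n + 1)) - f x) with hD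
  have hDK : ∀ n, ‖D n‖ ≤ K := fun n => by
    have hpos : (0 : ℝ) < 1 / (n + 1) := by positivity
    have := hf.dist_le_mul (x + 1 / (n + 1)) x
    rw [dist_eq_norm, Real.dist_eq, add_sub_cancel_left, abs_of_pos hpos] at this
    simp only [hD]
    rw [norm_smul, norm_inv, Real.norm_of_nonneg hpos.le, inv_mul_le_iff₀ hpos, mul_comm]
    exact this
  have hDlim : Tendsto (id fun n => D n : ℕ → ∀ _ : ℕ, 𝕜) atTop
      (𝓝 fun j => deriv (fun u => f u j) x) := by
    rw [tendsto_pi_nhds]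
    intro j
    have h1 := hasDerivAt_iff_tendsto_slope_zero.1 (hx j).hasDerivAt
    have h2 : Tendsto (fun n : ℕ => (1 : ℝ) / (n + 1)) atTop (𝓝[≠] 0) :=
      tendsto_nhdsWithin_iff.2 ⟨tendsto_one_div_add_atTop_nhds_zero_nat,
        Eventually.of_forall fun n => (show (1 : ℝ) / (n + 1) ≠ 0 by positivity)⟩
    exact h1.comp h2
  have hmem : Memℓp (fun j => deriv (fun u => f u j) x) s :=
    lp.memℓp_of_tendsto (isBounded_iff_forall_norm_le.2 ⟨K, by rintro _ ⟨n, rfl⟩; exact hDK n⟩)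
      hDlim
  refine ⟨⟨_, hmem⟩, fun j => (hx j).hasDerivAt, ?_⟩
  exact lp.norm_le_of_tendsto (Eventually.of_forall hDK) hDlim

theorem LipschitzWith.ae_hasDerivAt_lp (hs : s ≠ ∞) (hf : LipschitzWith K f) :
    ∀ᵐ x : ℝ, ∃ v : lp (fun _ : ℕ => 𝕜) s,
      (∀ j : ℕ, HasDerivAt (fun u => f u j) (v j) x) ∧ HasDerivAt f v x := by
  classical
  have hs0 : s ≠ 0 := (zero_lt_one.trans_le Fact.out).ne'
  have hcoord := hf.ae_differentiableAt_lp_apply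
  set A : Set ℝ := {x | ∀ j : ℕ, DifferentiableAt ℝ (fun u => f u j) x} with hA
  have hAm : MeasurableSet A := by
    rw [hA, Set.ofPred_forall]
    exact MeasurableSet.iInter fun j => measurableSet_of_differentiableAt ℝ _
  have hex : ∀ x, ∃ v : lp (fun _ : ℕ => 𝕜) s,
      (∀ j, v j = A.indicator (deriv fun u => f u j) x) ∧ ‖v‖ ≤ K ∧
      (x ∈ A → ∀ j, HasDerivAt (fun u => f u j) (v j) x) := fun x => by
    by_cases hx : x ∈ A
    · obtain ⟨v, hv, hvK⟩ := hf.exists_lp_hasDerivAt_apply hx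
      exact ⟨v, fun j => by rw [Set.indicator_of_mem hx, (hv j).deriv], hvK, fun _ => hv⟩
    · exact ⟨0, fun j => by rw [Set.indicator_of_notMem hx]; rfl, by simp, fun h => absurd h hx⟩
  choose g hg hgK hgA using hex
  -- Here `s ≠ ∞` is essential: finite truncations converge to `g x` in norm.
  have hgm : StronglyMeasurable g := by
    have h1 : ∀ n : ℕ, StronglyMeasurable fun x =>
        ∑ j ∈ Finset.range n, lp.single s j (g x j) := fun n => by
      refine Finset.stronglyMeasurable_fun_sum _ fun j _ => ?_
      have h2 : StronglyMeasurable fun x => g x j := by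
        have : (fun x => g x j) = A.indicator (deriv fun u => f u j) := funext fun x => hg x j
        rw [this]
        exact (stronglyMeasurable_deriv _).indicator hAm
      have h3 : Continuous fun c : 𝕜 => (lp.single s j c : lp (fun _ : ℕ => 𝕜) s) := by
        refine (LipschitzWith.of_dist_le_mul (K := 1) fun a b => ?_).continuous
        rw [dist_eq_norm, dist_eq_norm, NNReal.coe_one, one_mul, ← lp.single_sub,
          lp.norm_single (pos_iff_ne_zero.2 hs0)]
      exact h3.comp_stronglyMeasurable h2
    refine stronglyMeasurable_of_tendsto atTop h1 (tendsto_pi_nhds.2 fun x => ?_)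
    exact (lp.hasSum_single hs (g x)).tendsto_sum_nat
  have hint := fun r t => hgm.intervalIntegrable_of_norm_le hgK r t
  -- Evaluation at a coordinate commutes with the Bochner integral, which reduces the identity to
  -- scalar Lipschitz functions.
  have hftc : ∀ t, ∫ x in (0 : ℝ)..t, g x = f t - f 0 := fun t => by
    ext j
    have h1 := (lp.evalCLM ℝ (fun _ : ℕ => 𝕜) s j).intervalIntegral_comp_comm (hint 0 t)
    have h2 : ∫ x in (0 : ℝ)..t, g x j = ∫ x in (0 : ℝ)..t, deriv (fun u => f u j) x := by
      refine intervalIntegral.integral_congr_ae ?_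
      filter_upwards [hcoord] with x hx _
      rw [hg, Set.indicator_of_mem (show x ∈ A from hx)]
    rw [(hf.lp_apply j).integral_deriv_eq_sub_of_ae (hcoord.mono fun x hx => hx j)] at h2
    exact h1.symm.trans h2
  have hloc : LocallyIntegrable g volume :=
    (locallyIntegrable_const (K : ℝ)).mono hgm.aestronglyMeasurable
      (Eventually.of_forall fun x => (hgK x).trans (le_abs_self _))
  filter_upwards [hcoord, LocallyIntegrable.ae_hasDerivAt_integral hloc] with x h1 h2
  refine ⟨g x, hgA x h1, ?_⟩
  have h3 := (h2 0).add_const (f 0)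
  simpa only [hftc, sub_add_cancel] using h3

end SequenceSpaces

theorem mainTheorem1 {𝕜 : Type*} [RCLike 𝕜]
    {Y : Type*} [MeasurableSpace Y] (ν : Measure Y) [SigmaFinite ν]
    (p : ℝ≥0∞) [Fact (1 ≤ p)] (hp : 1 < p) (hp' : p ≠ ∞)
    (q : ℝ≥0∞) [Fact (1 ≤ q)] (hpq : p.HolderConjugate q)
    (H : Type*) [NormedAddCommGroup H] [InnerProductSpace 𝕜 H] [CompleteSpace H]
    [NormedSpace ℝ H] [IsScalarTower ℝ 𝕜 H] :
    -- Lipschitz maps from the line into `L^p(Y)`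
    (∀ (K : ℝ≥0) (f : ℝ → Lp 𝕜 p ν), LipschitzWith K f →
      ∃ G : ℝ × Y → 𝕜,
        (∀ a b : ℝ, MemLp G p ((volume.restrict (Set.Icc a b)).prod ν)) ∧
        (∀ r t : ℝ, r < t →
          IntervalIntegrable (sectionLp p ν G) volume r t ∧
          f t - f r = ∫ x in r..t, sectionLp p ν G x) ∧
        (∀ᵐ x : ℝ, HasDerivAt f (sectionLp p ν G x) x) ∧
        (HasCompactSupport f →
          MemLp G p ((volume : Measure ℝ).prod ν) ∧
          ∀ Φ : ℝ × Y → 𝕜, MemLp Φ q ((volume : Measure ℝ).prod ν) →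
            Tendsto (fun h : ℝ => pairingIntegral (fun x => h⁻¹ • (f (x + h) - f x)) Φ)
              (𝓝[≠] 0) (𝓝 (∫ z, G z * Φ z ∂((volume : Measure ℝ).prod ν))))) ∧
    -- paths of finite length in `L^p(Y)`
    (∀ (a b : ℝ) (f : ℝ → Lp 𝕜 p ν), a < b → BoundedVariationOn f (Set.Icc a b) →
      ∀ᵐ x : ℝ, x ∈ Set.Ioo a b → DifferentiableAt ℝ f x) ∧
    -- duality: continuous compactly supported maps define functionals on `L^q(ℝ × Y)`
    (∀ f : ℝ → Lp 𝕜 p ν, Continuous f → HasCompactSupport f →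
      ∃ L : Lp 𝕜 q ((volume : Measure ℝ).prod ν) →L[𝕜] 𝕜,
        (∀ Φ : Lp 𝕜 q ((volume : Measure ℝ).prod ν),
          (∀ᵐ x : ℝ, Integrable (fun y => f x y * Φ (x, y)) ν) ∧
          Integrable (fun x : ℝ => ∫ y, f x y * Φ (x, y) ∂ν) ∧
          L Φ = pairingIntegral f Φ) ∧
        ‖L‖ ≤ (∫ x : ℝ, ‖f x‖ ^ p.toReal) ^ (1 / p.toReal)) ∧
    -- Lipschitz maps from the line into `ℓ^s`, `1 ≤ s ≤ ∞`
    (∀ (s : ℝ≥0∞) [Fact (1 ≤ s)] (K : ℝ≥0) (f : ℝ → lp (fun _ : ℕ => 𝕜) s), LipschitzWith K f →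
      (∀ᵐ x : ℝ, ∀ j : ℕ, DifferentiableAt ℝ (fun u => f u j) x) ∧
      (∀ x : ℝ, (∀ j : ℕ, DifferentiableAt ℝ (fun u => f u j) x) →
        ∃ v : lp (fun _ : ℕ => 𝕜) s,
          (∀ j : ℕ, HasDerivAt (fun u => f u j) (v j) x) ∧ ‖v‖ ≤ K) ∧
      (∀ (j : ℕ) (r t : ℝ), r < t →
        IntervalIntegrable (deriv fun u => f u j) volume r t ∧
        f t j - f r j = ∫ x in r..t, deriv (fun u => f u j) x) ∧
      (s ≠ ∞ → ∀ᵐ x : ℝ, ∃ v : lp (fun _ : ℕ => 𝕜) s,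
        (∀ j : ℕ, HasDerivAt (fun u => f u j) (v j) x) ∧ HasDerivAt f v x)) ∧
    -- Hilbert spaces: Lipschitz maps, and paths of finite length
    (∀ (K : ℝ≥0) (f : ℝ → H), LipschitzWith K f → ∀ᵐ x : ℝ, DifferentiableAt ℝ f x) ∧
    (∀ (a b : ℝ) (f : ℝ → H), a < b → BoundedVariationOn f (Set.Icc a b) →
      ∀ᵐ x : ℝ, x ∈ Set.Ioo a b → DifferentiableAt ℝ f x) := by
  have hH : ∀ (K : ℝ≥0) (f : ℝ → H), LipschitzWith K f → ∀ᵐ x : ℝ, DifferentiableAt ℝ f x :=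
    fun K f hf => LipschitzWith.ae_differentiableAt_of_innerProductSpace 𝕜 K f hf
  refine ⟨fun K f hf => hf.exists_joint_derivative (q := q) hp hp', fun a b f hab hf => ?_,
    fun f hf hs => exists_continuousLinearMap_eq_pairingIntegral hp' hf hs, ?_, hH,
    fun a b f hab hf => hf.ae_differentiableAt_Ioo_of_forall_lipschitz hH hab⟩
  · have hL : ∀ (K : ℝ≥0) (f : ℝ → Lp 𝕜 p ν), LipschitzWith K f →
        ∀ᵐ x : ℝ, DifferentiableAt ℝ f x :=
      fun K f hf => LipschitzWith.ae_differentiableAt_of_Lp ν hp hp' K f hf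
    exact hf.ae_differentiableAt_Ioo_of_forall_lipschitz hL hab
  · intro s _ K f hf
    refine ⟨hf.ae_differentiableAt_lp_apply, fun x hx => hf.exists_lp_hasDerivAt_apply hx,
      fun j r t _ => ⟨(hf.lp_apply j).intervalIntegrable_deriv r t, ?_⟩,
      fun hs => hf.ae_hasDerivAt_lp hs⟩
    exact ((hf.lp_apply j).integral_deriv_eq_sub_of_ae
      (hf.ae_differentiableAt_lp_apply.mono fun x hx => hx j) r t).symm
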